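/- **Theorem 5.3** ($m$-times repeated Darboux transformation). Let $\mathbb K=\mathbb R$ or $\mathbb C$, let $n,N,m\ge 0$ be integers and $\alpha,\eta,\lambda_1,\dots,\lambda_N\in\mathbb K$. All functions are $C^\infty$ functions of $(x,t)\in\mathbb R^2$ with values in $\mathbb K$, $\partial=\partial_x$, and $\partial^{-1}g=\int_{-\infty}^x g\,dx$ is an improper integral. *Notation.* Let $b_0=0$, $b_1=1$, $b_{k+1}=Lb_k$ $(k\ge 1)$ with $L=-\tfrac14\partial^2-u+\tfrac12\partial^{-1}u_x$, and $a_k=-\tfrac12\partial b_k$; these are differential polynomials in $u$, and in $L$ (only) $\partial^{-1}$ is the antiderivative without constant term on differential polynomials. Put $A^{(n)}(u,\lambda)=\sum_{i=0}^{n+1}(a_i+b_i\partial)\lambda^{n+1-i}$. The $n$-th KdV equation with $N$ self-consistent sources is $$u_t=\partial\Big[-2b_{n+2}-2\alpha\sum_{j=1}^N\phi_j^2\Big],\qquad \phi_{j,xx}+(\lambda_j+u)\phi_j=0,\quad j=1,\dots,N, \tag{1}$$ and its linear problem with spectral parameter $\lambda$ is $$\psi_{xx}+(\lambda+u)\psi=0,\qquad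 \psi_t=A^{(n)}(u,\lambda)\psi+\eta\psi+\alpha\sum_{j=1}^N\phi_j\,\partial^{-1}(\phi_j\psi), \tag{2}$$ where the integrals are required to converge. For $\lambda\ne\lambda_j$ its integral-free form is $$\psi_{xx}+(\lambda+u)\psi=0,\qquad \psi_t=A^{(n)}(u,\lambda)\psi+\eta\psi+\alpha\sum_{j=1}^N\frac1{\lambda-\lambda_j}\phi_j(\phi_{j,x}\psi-\phi_j\psi_x). \tag{2'}$$ We say that *the product of $\phi$ and $\psi$ decays* if $\phi_x\psi-\phi\psi_x\to0$ as $x\to-\infty$ for every $t$. Finally $W(g_1,\dots,g_k)=\det(\partial^{i-1}g_j)_{i,j=1}^k$, and $\partial^2\ln g$ stands for $\partial(g_x/g)$. *Hypotheses.* Let $u,\phi_1,\dots,\phi_N$ solve (1). Let $f_1,\dots,f_m$ solve (2) with $\lambda=\xi_1,\dots,\xi_m$ respectively, where $\xi_i\neq\lambda_j$ for all $i,j$, and let the products of $\phi_j$ and $f_i$ decay. Let $\sqrt{\lambda_j-\xi_i}\in\mathbb K$ be fixed square roots (assumed to exist in $\mathbb K$). Put $u[0]=u$, $\psi[0]=\psi$,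 $f_k[0]=f_k$, $\phi_j[0]=\phi_j$ and, with $F_i=f_i[i-1]$ for $i=1,\dots,m$, $$\psi[i]=\psi[i-1]_x-\frac{F_{i,x}}{F_i}\psi[i-1],\qquad u[i]=u[i-1]+2\partial^2\ln F_i,\qquad \phi_j[i]=\frac{1}{\sqrt{\lambda_j-\xi_i}}\Big(\phi_j[i-1]_x-\frac{F_{i,x}}{F_i}\phi_j[i-1]\Big),$$ the $f_k[i]$ being formed like $\psi[i]$. Assume that $F_1,\dots,F_m$ vanish nowhere, so that every step is defined. *Conclusions.* $W(f_1,\dots,f_m)$ vanishes nowhere, and $$u[m]=u+2\partial^2\ln W(f_1,\dots,f_m),\qquad \phi_j[m]=\prod_{i=1}^m\frac1{\sqrt{\lambda_j-\xi_i}}\cdot\frac{W(f_1,\dots,f_m,\phi_j)}{W(f_1,\dots,f_m)},\quad j=1,\dots,N,$$ and $u[m],\phi_1[m],\dots,\phi_N[m]$ are again a solution of (1), with the same $\alpha$ and $\lambda_j$. Moreover, for every $\lambda\notin\{\lambda_1,\dots,\lambda_N\}$ and every solution $\psi$ of (2) such that the products of $\phi_j$ and $\psi$ decay, $$\psi[m]=\frac{W(f_1,\dots,f_m,\psi)}{W(f_1,\dots,f_m)},$$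 and $\psi[m]$ solves (2') with $u,\phi_j$ replaced by $u[m],\phi_j[m]$; if also the products of $\phi_j[m]$ and $\psi[m]$ decay, then $\psi[m]$ solves (2) with $u,\phi_j$ replaced by $u[m],\phi_j[m]$. -/

import Mathlib

open Filter Topology
open scoped ContDiff

namespace KdVSource

/-! ### Differential polynomials in one function `u` -/

section DiffPoly

/-- Differential polynomials in `u` with rational coefficients: the variable `X i` stands for
the `i`-th derivative of `u`. -/
abbrev DiffPoly : Type := MvPolynomial ℕ ℚ

/-- The total derivative `∂`, with `∂ u⁽ⁱ⁾ = u⁽ⁱ⁺¹⁾`. -/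
noncomputable def D : Derivation ℚ DiffPoly DiffPoly :=
  MvPolynomial.mkDerivation ℚ (fun i => MvPolynomial.X (i + 1))

open Classical in
/-- `∂⁻¹` on differential polynomials: the antiderivative without constant term (it is unique,
see `antiderivative_unique`; the value is `0` if there is none). -/
noncomputable def invD (P : DiffPoly) : DiffPoly :=
  if h : ∃ Q : DiffPoly, D Q = P ∧ MvPolynomial.constantCoeff Q = 0 then h.choose else 0

/-- The recursion operator `L = -¼ ∂² - u + ½ ∂⁻¹ u_x`. -/
noncomputable def lenard (P : DiffPoly) : DiffPoly :=
  -MvPolynomial.C (1 / 4 : ℚ) * D (D P) - MvPolynomial.X 0 * P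
    + MvPolynomial.C (1 / 2 : ℚ) * invD (MvPolynomial.X 1 * P)

/-- The differential polynomials `b_0 = 0`, `b_1 = 1`, `b_{k+1} = L b_k` for `k ≥ 1`. -/
noncomputable def b : ℕ → DiffPoly
  | 0 => 0
  | 1 => 1
  | k + 2 => lenard (b (k + 1))

/-- `a_k = -½ ∂ b_k`. -/
noncomputable def a (k : ℕ) : DiffPoly := -MvPolynomial.C (1 / 2 : ℚ) * D (b k)

/-! Helper facts: antiderivatives without constant term are unique, and those that occur in the
recursion exist, so that the default value in `invD` is never used there. -/

theorem D_X (i : ℕ) : D (MvPolynomial.X i) = MvPolynomial.X (i + 1) := by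
  simp [D, MvPolynomial.mkDerivation_X]

theorem D_C (c : ℚ) : D (MvPolynomial.C c) = 0 := by
  simp [D]

theorem pderiv_succ_D (i : ℕ) (Q : DiffPoly) :
    MvPolynomial.pderiv (i + 1) (D Q)
      = D (MvPolynomial.pderiv (i + 1) Q) + MvPolynomial.pderiv i Q := by
  induction Q using MvPolynomial.induction_on with
  | C c => simp
  | add p q hp hq => simp only [map_add, hp, hq]; ring
  | mul_X p j hp =>
    simp only [Derivation.leibniz, map_add, smul_eq_mul, D_X, hp, MvPolynomial.pderiv_X,
      Pi.single_apply]
    by_cases h1 : j = i + 1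
    · subst h1; simp; ring
    · by_cases h2 : j = i
      · subst h2; simp; ring
      · have h3 : ¬ (j + 1 = i + 1) := by omega
        simp [h1, h2]; ring

theorem pderiv_eq_zero_of_D_eq_zero (Q : DiffPoly) (h : D Q = 0) (i : ℕ) :
    MvPolynomial.pderiv i Q = 0 := by
  obtain ⟨M, hM⟩ : ∃ M, ∀ j, M ≤ j → MvPolynomial.pderiv j Q = 0 := by
    refine ⟨Q.vars.sup id + 1, fun j hj => MvPolynomial.pderiv_eq_zero_of_notMem_vars ?_⟩
    intro hmem
    have := Finset.le_sup (f := id) hmem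
    simp only [id] at this
    omega
  have step : ∀ k j, M ≤ j + k → MvPolynomial.pderiv j Q = 0 := by
    intro k
    induction k with
    | zero => intro j hj; exact hM j hj
    | succ k ih =>
      intro j hj
      have h1 := pderiv_succ_D j Q
      rw [h, ih (j + 1) (by omega)] at h1
      simpa using h1.symm
  exact step M i (by omega)

theorem eq_C_of_D_eq_zero (Q : DiffPoly) (h : D Q = 0) :
    Q = MvPolynomial.C (MvPolynomial.constantCoeff Q) := by
  ext d
  rw [MvPolynomial.coeff_C]
  by_cases hd : d = 0
  · subst hd; simp [MvPolynomial.constantCoeff_eq]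
  · rw [if_neg (Ne.symm hd)]
    obtain ⟨i, hi⟩ : ∃ i, d i ≠ 0 := by
      by_contra hcon
      push Not at hcon
      exact hd (Finsupp.ext hcon)
    have h1 := congrArg (MvPolynomial.coeff (d - Finsupp.single i 1))
      (pderiv_eq_zero_of_D_eq_zero Q h i)
    rw [MvPolynomial.coeff_pderiv] at h1
    have h2 : d - Finsupp.single i 1 + Finsupp.single i 1 = d := by
      apply tsub_add_cancel_of_le
      simpa using Nat.one_le_iff_ne_zero.mpr hi
    rw [h2] at h1
    have h3 : (((d - Finsupp.single i 1 : ℕ →₀ ℕ) i : ℚ) + 1) ≠ 0 := by positivity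
    rw [MvPolynomial.coeff_zero] at h1
    exact (mul_eq_zero.mp h1).resolve_right h3

theorem antiderivative_unique (Q R : DiffPoly) (h : D Q = D R)
    (hc : MvPolynomial.constantCoeff Q = MvPolynomial.constantCoeff R) : Q = R := by
  have h1 := eq_C_of_D_eq_zero (Q - R) (by rw [map_sub, h, sub_self])
  rw [map_sub, hc, sub_self, map_zero] at h1
  exact sub_eq_zero.mp h1

theorem invD_spec (P Q : DiffPoly) (h : D Q = P) :
    D (invD P) = P ∧ MvPolynomial.constantCoeff (invD P) = 0 := by
  have hex : ∃ Q : DiffPoly, D Q = P ∧ MvPolynomial.constantCoeff Q = 0 :=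
    ⟨Q - MvPolynomial.C (MvPolynomial.constantCoeff Q), by rw [map_sub, D_C, sub_zero, h], by simp⟩
  rw [invD, dif_pos hex]
  exact hex.choose_spec

theorem D_C_mul (c : ℚ) (P : DiffPoly) :
    D (MvPolynomial.C c * P) = MvPolynomial.C c * D P := by
  rw [Derivation.leibniz, D_C]; simp

theorem constantCoeff_D (P : DiffPoly) : MvPolynomial.constantCoeff (D P) = 0 := by
  induction P using MvPolynomial.induction_on with
  | C c => simp
  | add p q hp hq => simp [hp, hq]
  | mul_X p j hp => simp [D_X, hp]

theorem constantCoeff_b (k : ℕ) : MvPolynomial.constantCoeff (b (k + 2)) = 0 := by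
  have h : MvPolynomial.constantCoeff (invD (MvPolynomial.X 1 * b (k + 1))) = 0 := by
    by_cases hex : ∃ Q : DiffPoly, D Q = MvPolynomial.X 1 * b (k + 1) ∧
        MvPolynomial.constantCoeff Q = 0
    · rw [invD, dif_pos hex]; exact hex.choose_spec.2
    · rw [invD, dif_neg hex]; simp
  simp [b, lenard, constantCoeff_D, h]

/-- `∂ b_{k+2} = -¼ ∂³ b_{k+1} - u ∂ b_{k+1} - ½ u_x b_{k+1}`. -/
theorem D_b (k : ℕ) :
    D (b (k + 2)) = -MvPolynomial.C (1 / 4 : ℚ) * D (D (D (b (k + 1))))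
      - MvPolynomial.X 0 * D (b (k + 1))
      - MvPolynomial.C (1 / 2 : ℚ) * (MvPolynomial.X 1 * b (k + 1)) := by
  have hhalf : (MvPolynomial.C (1 / 2 : ℚ) : DiffPoly) * 2 = 1 := by
    rw [← map_ofNat MvPolynomial.C 2, ← map_mul]; norm_num
  have key : ∀ k, D (invD (MvPolynomial.X 1 * b (k + 1))) = MvPolynomial.X 1 * b (k + 1) →
      D (b (k + 2)) = -MvPolynomial.C (1 / 4 : ℚ) * D (D (D (b (k + 1))))
      - MvPolynomial.X 0 * D (b (k + 1))
      - MvPolynomial.C (1 / 2 : ℚ) * (MvPolynomial.X 1 * b (k + 1)) := by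
    intro k hk
    rw [b, lenard, map_add, map_sub, D_C_mul, hk, neg_mul, map_neg, D_C_mul, Derivation.leibniz,
      D_X]
    simp only [smul_eq_mul]
    linear_combination (MvPolynomial.X 1 * b (k + 1)) * hhalf
  -- skew symmetry of `-¼ ∂³ - u ∂ - ½ u_x` modulo total derivatives
  have skew : ∀ P Q : DiffPoly, ∃ S, D S =
      P * (-MvPolynomial.C (1 / 4 : ℚ) * D (D (D Q)) - MvPolynomial.X 0 * D Q
        - MvPolynomial.C (1 / 2 : ℚ) * (MvPolynomial.X 1 * Q))
      + Q * (-MvPolynomial.C (1 / 4 : ℚ) * D (D (D P)) - MvPolynomial.X 0 * D P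
        - MvPolynomial.C (1 / 2 : ℚ) * (MvPolynomial.X 1 * P)) := by
    intro P Q
    refine ⟨-MvPolynomial.C (1 / 4 : ℚ) * (P * D (D Q) + Q * D (D P) - D P * D Q)
      - MvPolynomial.X 0 * (P * Q), ?_⟩
    rw [map_sub, neg_mul, map_neg, D_C_mul]
    simp only [map_add, map_sub, Derivation.leibniz, smul_eq_mul, D_X]
    linear_combination (MvPolynomial.X 1 * P * Q) * hhalf
  have main : ∀ k, D (invD (MvPolynomial.X 1 * b (k + 1))) = MvPolynomial.X 1 * b (k + 1) := by
    intro k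
    induction k using Nat.strong_induction_on with
    | _ k ih =>
    have hD : ∀ i, i < k → D (b (i + 2)) = -MvPolynomial.C (1 / 4 : ℚ) * D (D (D (b (i + 1))))
        - MvPolynomial.X 0 * D (b (i + 1))
        - MvPolynomial.C (1 / 2 : ℚ) * (MvPolynomial.X 1 * b (i + 1)) :=
      fun i hi => key i (ih i hi)
    have hb1 : b 1 = 1 := by simp [b]
    by_cases hk : k = 0
    · subst hk
      exact (invD_spec _ (MvPolynomial.X 0) (by rw [zero_add, hb1, D_X, mul_one])).1
    -- `b_{k+1-i} ∂ b_{i+2} ≡ b_{k+1} ∂ b_2` modulo total derivatives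
    have move : ∀ i, i < k → ∃ S, D S =
        b (k + 1) * D (b 2) - b (k + 1 - i) * D (b (i + 2)) := by
      intro i
      induction i with
      | zero => intro _; exact ⟨0, by simp⟩
      | succ i hi =>
        intro hik
        obtain ⟨S, hS⟩ := hi (by omega)
        obtain ⟨l, hl⟩ : ∃ l, k + 1 - i = l + 2 ∧ k + 1 - (i + 1) = l + 1 ∧ l < k :=
          ⟨k - 1 - i, by omega, by omega, by omega⟩
        obtain ⟨T, hT⟩ := skew (b (l + 1)) (b (i + 1 + 1))
        refine ⟨S + b (l + 2) * b (i + 2) - T, ?_⟩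
        have e1 := hD l hl.2.2
        have e2 := hD (i + 1) hik
        rw [hl.1] at hS
        rw [hl.2.1, map_sub, map_add, hS, hT, Derivation.leibniz, ← e1, ← e2]
        simp only [smul_eq_mul]
        ring
    obtain ⟨S, hS⟩ := move (k - 1) (by omega)
    have h1 : k + 1 - (k - 1) = 2 := by omega
    have h2 : k - 1 + 2 = k + 1 := by omega
    rw [h1, h2] at hS
    have hb2 := hD 0 (by omega)
    have hD1 : D (1 : DiffPoly) = 0 := by simp
    simp only [zero_add, hb1, hD1, map_zero, mul_zero, mul_one, sub_zero, zero_sub] at hb2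
    refine (invD_spec _ (-(S + b 2 * b (k + 1))) ?_).1
    rw [map_neg, map_add, hS, Derivation.leibniz]
    simp only [smul_eq_mul]
    rw [hb2]
    linear_combination (MvPolynomial.X 1 * b (k + 1)) * hhalf
  exact key k (main k)

end DiffPoly

/-! ### Functions of `(x, t)` -/

section Functions

variable {𝕜 : Type*} [RCLike 𝕜]

/-- Joint smoothness of a function of `(x, t)`. -/
def Smooth (g : ℝ → ℝ → 𝕜) : Prop := ContDiff ℝ ∞ (fun p : ℝ × ℝ => g p.1 p.2)

/-- `∂g/∂x`. -/
noncomputable def dx (g : ℝ → ℝ → 𝕜) : ℝ → ℝ → 𝕜 := fun x t => deriv (fun y => g y t) x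

/-- `∂g/∂t`. -/
noncomputable def dt (g : ℝ → ℝ → 𝕜) : ℝ → ℝ → 𝕜 := fun x t => deriv (fun r => g x r) t

/-- `∂² ln g = ∂ (g_x / g)`. -/
noncomputable def d2log (g : ℝ → ℝ → 𝕜) : ℝ → ℝ → 𝕜 := dx (fun x t => dx g x t / g x t)

/-- The integral of `g` from `-∞` to `x` converges (as an improper integral), for all `x`, `t`. -/
def InvDxConverges (g : ℝ → ℝ → 𝕜) : Prop :=
  ∀ x t, ∃ I : 𝕜, Tendsto (fun r : ℝ => ∫ y in r..x, g y t) atBot (𝓝 I)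

/-- `∂⁻¹ g = ∫_{-∞}^x g`, an improper integral. -/
noncomputable def invDx (g : ℝ → ℝ → 𝕜) : ℝ → ℝ → 𝕜 :=
  fun x t => limUnder atBot (fun r : ℝ => ∫ y in r..x, g y t)

/-- The value `P[u](x, t)` of a differential polynomial. -/
noncomputable def evalDiff (P : DiffPoly) (u : ℝ → ℝ → 𝕜) : ℝ → ℝ → 𝕜 :=
  fun x t => MvPolynomial.aeval (fun i => iteratedDeriv i (fun y => u y t) x) P

/-- `A⁽ⁿ⁾(u, μ) ψ = ∑_{i=0}^{n+1} (a_i[u] ψ + b_i[u] ψ_x) μ^{n+1-i}`. -/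
noncomputable def opA (n : ℕ) (u : ℝ → ℝ → 𝕜) (μ : 𝕜) (ψ : ℝ → ℝ → 𝕜) : ℝ → ℝ → 𝕜 :=
  fun x t => ∑ i ∈ Finset.range (n + 2),
    (evalDiff (a i) u x t * ψ x t + evalDiff (b i) u x t * dx ψ x t) * μ ^ (n + 1 - i)

/-- The Schrödinger equation `ψ_xx + (μ + u) ψ = 0`. -/
def Schrodinger (u : ℝ → ℝ → 𝕜) (μ : 𝕜) (ψ : ℝ → ℝ → 𝕜) : Prop :=
  ∀ x t, dx (dx ψ) x t + (μ + u x t) * ψ x t = 0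

/-- `u, φ_1, …, φ_N` is a smooth solution of the `n`-th KdV equation with self-consistent sources
`u_t = ∂ [-2 b_{n+2}[u] - 2 α ∑_j φ_j²]`, `φ_{j,xx} + (λ_j + u) φ_j = 0`. -/
structure IsSourceSolution (n : ℕ) {N : ℕ} (α : 𝕜) (lam : Fin N → 𝕜)
    (u : ℝ → ℝ → 𝕜) (φ : Fin N → ℝ → ℝ → 𝕜) : Prop where
  smooth_u : Smooth u
  smooth_φ : ∀ j, Smooth (φ j)
  evolution : ∀ x t, dt u x t =
    dx (fun x t => -2 * evalDiff (b (n + 2)) u x t - 2 * α * ∑ j, φ j x t ^ 2) x t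
  spectral : ∀ j, Schrodinger u (lam j) (φ j)

/-- `ψ` is a smooth solution of the auxiliary linear problem with spectral parameter `μ`:
`ψ_xx + (μ + u) ψ = 0`, `ψ_t = A⁽ⁿ⁾ ψ + η ψ + α ∑_j φ_j ∂⁻¹(φ_j ψ)`, the integrals `∂⁻¹(φ_j ψ)`
being convergent. -/
structure IsLaxSolution (n : ℕ) {N : ℕ} (α η : 𝕜) (u : ℝ → ℝ → 𝕜) (φ : Fin N → ℝ → ℝ → 𝕜)
    (μ : 𝕜) (ψ : ℝ → ℝ → 𝕜) : Prop where
  smooth : Smooth ψ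
  schrodinger : Schrodinger u μ ψ
  converges : ∀ j, InvDxConverges (fun x t => φ j x t * ψ x t)
  evolution : ∀ x t, dt ψ x t = opA n u μ ψ x t + η * ψ x t
    + α * ∑ j, φ j x t * invDx (fun x t => φ j x t * ψ x t) x t

/-- `ψ` is a smooth solution of the auxiliary linear problem in its integral-free form:
`ψ_xx + (μ + u) ψ = 0`,
`ψ_t = A⁽ⁿ⁾ ψ + η ψ + α ∑_j (μ - λ_j)⁻¹ φ_j (φ_{j,x} ψ - φ_j ψ_x)`. -/
structure IsLocalLaxSolution (n : ℕ) {N : ℕ} (α η : 𝕜) (lam : Fin N → 𝕜) (u : ℝ → ℝ → 𝕜)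
    (φ : Fin N → ℝ → ℝ → 𝕜) (μ : 𝕜) (ψ : ℝ → ℝ → 𝕜) : Prop where
  smooth : Smooth ψ
  schrodinger : Schrodinger u μ ψ
  evolution : ∀ x t, dt ψ x t = opA n u μ ψ x t + η * ψ x t
    + α * ∑ j, 1 / (μ - lam j) *
        (φ j x t * (dx (φ j) x t * ψ x t - φ j x t * dx ψ x t))

/-- Decay of the product of `φ` and `ψ` at `x = -∞`, in the weak form that is needed to integrate
`(φ_x ψ - φ ψ_x)_x` from `-∞`: the boundary term `φ_x ψ - φ ψ_x` tends to `0` for every `t`. -/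
def DecaysAtBot (φ ψ : ℝ → ℝ → 𝕜) : Prop :=
  ∀ t, Tendsto (fun x => dx φ x t * ψ x t - φ x t * dx ψ x t) atBot (𝓝 0)

/-- The Darboux transform `g_x - (f_x / f) g` of `g` with seed `f`. -/
noncomputable def darboux (f g : ℝ → ℝ → 𝕜) : ℝ → ℝ → 𝕜 :=
  fun x t => dx g x t - dx f x t / f x t * g x t

/-- `g[i]`, the `i`-times repeated Darboux transform of `g` with seeds `f 0, f 1, …`; the seed of
the step from `i` to `i + 1` is `(f i)[i]`. -/
noncomputable def iter (f : ℕ → ℝ → ℝ → 𝕜) : ℕ → (ℝ → ℝ → 𝕜) → ℝ → ℝ → 𝕜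
  | 0, g => g
  | i + 1, g => darboux (iter f i (f i)) (iter f i g)

/-- `u[i]`: each step adds `2 ∂² ln` of the seed of that step. -/
noncomputable def iterU (f : ℕ → ℝ → ℝ → 𝕜) (u : ℝ → ℝ → 𝕜) : ℕ → ℝ → ℝ → 𝕜
  | 0 => u
  | i + 1 => fun x t => iterU f u i x t + 2 * d2log (iter f i (f i)) x t

/-- `φ[i]` for a source `φ`: each step is the Darboux transform divided by `s i`, where `s i` is
the square root of `λ - ξ_i`. -/
noncomputable def iterSource (f : ℕ → ℝ → ℝ → 𝕜) (s : ℕ → 𝕜) (φ : ℝ → ℝ → 𝕜) :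
    ℕ → ℝ → ℝ → 𝕜
  | 0 => φ
  | i + 1 => fun x t => 1 / s i * darboux (iter f i (f i)) (iterSource f s φ i) x t

/-- The Wronskian determinant `W(g_1, …, g_k) = det (∂^{i-1} g_j / ∂x^{i-1})`. -/
noncomputable def wronskian {k : ℕ} (g : Fin k → ℝ → ℝ → 𝕜) : ℝ → ℝ → 𝕜 :=
  fun x t => Matrix.det (Matrix.of fun i j : Fin k => iteratedDeriv i (fun y => g j y t) x)

end Functions

end KdVSource

/-! For a seed `f` with parameter `ξ` put `v = f_x / f`. The Schrödinger equation of `f` becomes the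
Riccati equation `u = -v_x - v² - ξ`, and the transformed potential is `w = u + 2 v_x = v_x - v² -
ξ`. A Darboux step is thus the change of sign `v ↦ -v` in the Miura map. The `b_k` at `u` and at `w`
are tied by `(∂ - 2v) b_k[u] + (∂ + 2v) b_k[w] = 0` and by a companion relation that raises `k`
(`miura_b`). Both follow by induction on `k` from the Lenard recursion, in the ring of differential
polynomials in `v`, where identities can be integrated because only constants have derivative zero
(`miura_b_universal`).

The sources fit in because a source and its transform form a first order system (`SourcePair`), so
that their squares obey relations of the same kind. Everything then passes through one coefficient
`B(μ) = ∑ b_i μ^(n+1-i) - α ∑ φ_j² / (μ - λ_j)` (`laxB`): the integral-free linear problem reads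
`ψ_t = -½ B_x ψ + B ψ_x + η ψ`. For the seed this gives `2 v_t = -∂(∂ - 2v) B(ξ) = ∂(∂ + 2v) B'(ξ)`,
with `B'` formed from the new data. Applying `∂ - 2v` yields the equation with sources for `w`
(`evolution_potential`), and the relations at general `μ` yield the linear problem for `ψ_x - v ψ`
(`evolution_darboux`).

The integral-free problem is local, so these steps iterate with no boundary conditions in between.
Decay enters only at the two ends, where `(φ_x ψ - φ ψ_x)_x = (μ - λ) φ ψ` identifies the integrals
(`tendsto_integral_mul`). The Wronskian formulas hold because the `m`-fold transform is a monic
differential operator of order `m` that annihilates every `f_i` (`ringWronskian_snoc`). -/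

namespace KdVSource

/-! ### Differential polynomials in a differential algebra -/

section Algebra

variable {K R S : Type*} [Field K] [CommRing R] [Algebra K R] [CommRing S]
  [Algebra K S]

/-- The derivation `X i ↦ X (i + 1)` of the differential polynomials in one variable over `K`. -/
noncomputable def shiftDeriv (K : Type*) [Field K] :
    Derivation K (MvPolynomial ℕ K) (MvPolynomial ℕ K) :=
  MvPolynomial.mkDerivation K (fun i => MvPolynomial.X (i + 1))

theorem shiftDeriv_X (i : ℕ) :
    shiftDeriv K (MvPolynomial.X i) = MvPolynomial.X (i + 1) := by
  simp [shiftDeriv, MvPolynomial.mkDerivation_X]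

theorem shiftDeriv_C (c : K) : shiftDeriv K (MvPolynomial.C c) = 0 := by
  simp [shiftDeriv]

theorem constantCoeff_shiftDeriv (P : MvPolynomial ℕ K) :
    MvPolynomial.constantCoeff (shiftDeriv K P) = 0 := by
  induction P using MvPolynomial.induction_on with
  | C c => simp
  | add p q hp hq => simp [hp, hq]
  | mul_X p j hp => simp [shiftDeriv_X, hp]

theorem pderiv_succ_shiftDeriv (i : ℕ) (Q : MvPolynomial ℕ K) :
    MvPolynomial.pderiv (i + 1) (shiftDeriv K Q)
      = shiftDeriv K (MvPolynomial.pderiv (i + 1) Q) + MvPolynomial.pderiv i Q := by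
  induction Q using MvPolynomial.induction_on with
  | C c => simp
  | add p q hp hq => simp only [map_add, hp, hq]; ring
  | mul_X p j hp =>
    simp only [Derivation.leibniz, map_add, smul_eq_mul, shiftDeriv_X, hp, MvPolynomial.pderiv_X,
      Pi.single_apply]
    by_cases h1 : j = i + 1
    · subst h1; simp; ring
    · by_cases h2 : j = i
      · subst h2; simp; ring
      · simp [h1, h2]; ring

variable [CharZero K]

/-- The value of a differential polynomial at an element of a differential algebra. -/
noncomputable def evalAt (d : Derivation K R R) (u : R) : DiffPoly →+* R :=
  MvPolynomial.eval₂Hom ((algebraMap K R).comp (algebraMap ℚ K)) (fun i => d^[i] u)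

theorem evalAt_X (d : Derivation K R R) (u : R) (i : ℕ) :
    evalAt d u (MvPolynomial.X i) = d^[i] u := by
  simp [evalAt]

theorem evalAt_C (d : Derivation K R R) (u : R) (c : ℚ) :
    evalAt d u (MvPolynomial.C c) = algebraMap K R (c : K) := by
  simp [evalAt]

theorem evalAt_D (d : Derivation K R R) (u : R) (P : DiffPoly) :
    evalAt d u (D P) = d (evalAt d u P) := by
  induction P using MvPolynomial.induction_on with
  | C c => rw [D_C, map_zero, evalAt_C, Derivation.map_algebraMap]
  | add p q hp hq => simp only [map_add, hp, hq]
  | mul_X p j hp =>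
    simp only [Derivation.leibniz, smul_eq_mul, map_add, map_mul, hp, D_X, evalAt_X,
      Function.iterate_succ_apply']

/-- Allows identities proved in the universal ring of differential polynomials to be specialized to
any differential algebra. -/
theorem evalAt_map (d : Derivation K R R) (d' : Derivation K S S) (θ : R →ₐ[K] S)
    (h : ∀ r, θ (d r) = d' (θ r)) (u : R) (P : DiffPoly) :
    θ (evalAt d u P) = evalAt d' (θ u) P := by
  have hiter : ∀ i : ℕ, θ (d^[i] u) = d'^[i] (θ u) := by
    intro i
    induction i with
    | zero => rfl
    | succ i ih => rw [Function.iterate_succ_apply', Function.iterate_succ_apply', h, ih]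
  induction P using MvPolynomial.induction_on with
  | C c => rw [evalAt_C, evalAt_C, AlgHom.commutes]
  | add p q hp hq => simp only [map_add, hp, hq]
  | mul_X p j hp => simp only [map_mul, hp, evalAt_X, hiter]

theorem four_mul_algebraMap : (4 : R) * algebraMap K R (1 / 4) = 1 := by
  rw [← map_ofNat (algebraMap K R) 4, ← map_mul]; norm_num

theorem two_mul_algebraMap : (2 : R) * algebraMap K R (1 / 2) = 1 := by
  rw [← map_ofNat (algebraMap K R) 2, ← map_mul]; norm_num

theorem two_mul_cancel (K : Type*) {R : Type*} [Field K] [CharZero K] [CommRing R] [Algebra K R]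
    {a b : R} (h : 2 * a = 2 * b) : a = b := by
  linear_combination algebraMap K R (1 / 2) * h + (b - a) * two_mul_algebraMap (K := K) (R := R)

/-- The Lenard recursion in a differential algebra. -/
theorem four_mul_deriv_b_succ (d : Derivation K R R) (u : R) (k : ℕ) :
    4 * d (evalAt d u (b (k + 1))) = -d (d (d (evalAt d u (b k))))
      - 4 * u * d (evalAt d u (b k)) - 2 * d u * evalAt d u (b k) := by
  cases k with
  -- `b_1 = 1` is not `L b_0`, but the differentiated recursion still holds here: both sides are
  -- zero. Later inductions can therefore start at `k = 0`.
  | zero => simp [b]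
  | succ k =>
    rw [← evalAt_D, D_b]
    simp only [map_sub, map_mul, map_neg, evalAt_C, evalAt_D, evalAt_X, Function.iterate_zero_apply,
      Function.iterate_one]
    push_cast
    linear_combination (-d (d (d (evalAt d u (b (k + 1)))))) *
        four_mul_algebraMap (K := K) (R := R)
      - 2 * d u * evalAt d u (b (k + 1)) * two_mul_algebraMap (K := K) (R := R)

/-- The partial derivatives vanish beyond the highest variable of `Q`, and the commutator formula
`pderiv_succ_shiftDeriv` carries this vanishing down one index at a time. In characteristic zero no
nonconstant monomial is left. -/
theorem eq_C_of_shiftDeriv_eq_zero (Q : MvPolynomial ℕ K) (h : shiftDeriv K Q = 0) :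
    Q = MvPolynomial.C (MvPolynomial.constantCoeff Q) := by
  have hpd : ∀ i, MvPolynomial.pderiv i Q = 0 := by
    obtain ⟨M, hM⟩ : ∃ M, ∀ j, M ≤ j → MvPolynomial.pderiv j Q = 0 := by
      refine ⟨Q.vars.sup id + 1, fun j hj => MvPolynomial.pderiv_eq_zero_of_notMem_vars ?_⟩
      intro hmem
      have := Finset.le_sup (f := id) hmem
      simp only [id] at this
      omega
    have step : ∀ k j, M ≤ j + k → MvPolynomial.pderiv j Q = 0 := by
      intro k
      induction k with
      | zero => intro j hj; exact hM j hj
      | succ k ih =>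
        intro j hj
        have h1 := pderiv_succ_shiftDeriv j Q
        rw [h, ih (j + 1) (by omega)] at h1
        simpa using h1.symm
    exact fun i => step M i (by omega)
  ext e
  rw [MvPolynomial.coeff_C]
  by_cases he : e = 0
  · subst he; simp [MvPolynomial.constantCoeff_eq]
  · rw [if_neg (Ne.symm he)]
    obtain ⟨i, hi⟩ : ∃ i, e i ≠ 0 := by
      by_contra hcon
      push Not at hcon
      exact he (Finsupp.ext hcon)
    have h1 := congrArg (MvPolynomial.coeff (e - Finsupp.single i 1)) (hpd i)
    rw [MvPolynomial.coeff_pderiv] at h1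
    have h2 : e - Finsupp.single i 1 + Finsupp.single i 1 = e := by
      apply tsub_add_cancel_of_le
      simpa using Nat.one_le_iff_ne_zero.mpr hi
    rw [h2, MvPolynomial.coeff_zero] at h1
    exact (mul_eq_zero.mp h1).resolve_right (Nat.cast_add_one_ne_zero _)

/-- The constant term of `P[u]` only depends on that of `u`. -/
theorem constantCoeff_evalAt (u w : MvPolynomial ℕ K)
    (h : MvPolynomial.constantCoeff u = MvPolynomial.constantCoeff w) (P : DiffPoly) :
    MvPolynomial.constantCoeff (evalAt (shiftDeriv K) u P)
      = MvPolynomial.constantCoeff (evalAt (shiftDeriv K) w P) := by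
  induction P using MvPolynomial.induction_on with
  | C c => rw [evalAt_C, evalAt_C]
  | add p q hp hq => simp only [map_add, hp, hq]
  | mul_X p j hp =>
    simp only [map_mul, hp, evalAt_X]
    cases j with
    | zero => rw [Function.iterate_zero_apply, Function.iterate_zero_apply, h]
    | succ j => simp only [Function.iterate_succ_apply', constantCoeff_shiftDeriv]

/-- The Miura relations between `b_k[-v_x - v² - ξ]` and `b_k[v_x - v² - ξ]`, for differential
polynomials in `v`. -/
theorem miura_b_universal (ξ : K) (v u w : MvPolynomial ℕ K) (hv : v = MvPolynomial.X 0)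
    (hu : u = -shiftDeriv K v - v ^ 2 - MvPolynomial.C ξ)
    (hw : w = shiftDeriv K v - v ^ 2 - MvPolynomial.C ξ) (k : ℕ) :
    (shiftDeriv K (evalAt (shiftDeriv K) u (b k)) - 2 * v * evalAt (shiftDeriv K) u (b k)
      + (shiftDeriv K (evalAt (shiftDeriv K) w (b k)) + 2 * v * evalAt (shiftDeriv K) w (b k)) = 0)
    ∧ 2 * (evalAt (shiftDeriv K) w (b (k + 1)) - evalAt (shiftDeriv K) u (b (k + 1))
        - MvPolynomial.C ξ *
          (evalAt (shiftDeriv K) w (b k) - evalAt (shiftDeriv K) u (b k)))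
      + shiftDeriv K (shiftDeriv K (evalAt (shiftDeriv K) w (b k))
        + 2 * v * evalAt (shiftDeriv K) w (b k)) = 0 := by
  -- Both potentials have constant term `-ξ`. This fixes the constant of integration below.
  have hcc : ∀ P : DiffPoly, MvPolynomial.constantCoeff (evalAt (shiftDeriv K) w P)
      = MvPolynomial.constantCoeff (evalAt (shiftDeriv K) u P) := by
    refine constantCoeff_evalAt w u ?_
    simp [hu, hw, hv, constantCoeff_shiftDeriv]
  have hu4 := four_mul_deriv_b_succ (shiftDeriv K) u
  have hw4 := four_mul_deriv_b_succ (shiftDeriv K) w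
  have h2 : shiftDeriv K (2 : MvPolynomial ℕ K) = 0 := by
    rw [← map_ofNat (MvPolynomial.C : K →+* MvPolynomial ℕ K) 2, shiftDeriv_C]
  have hdu : shiftDeriv K u = -shiftDeriv K (shiftDeriv K v) - 2 * v * shiftDeriv K v := by
    rw [hu]; simp only [map_sub, map_neg, pow_two, Derivation.leibniz, shiftDeriv_C, smul_eq_mul]
    ring
  have hdw : shiftDeriv K w = shiftDeriv K (shiftDeriv K v) - 2 * v * shiftDeriv K v := by
    rw [hw]; simp only [map_sub, pow_two, Derivation.leibniz, shiftDeriv_C, smul_eq_mul]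
    ring
  have second : ∀ k, shiftDeriv K (evalAt (shiftDeriv K) u (b k))
        - 2 * v * evalAt (shiftDeriv K) u (b k)
        + (shiftDeriv K (evalAt (shiftDeriv K) w (b k))
          + 2 * v * evalAt (shiftDeriv K) w (b k)) = 0 →
      2 * (evalAt (shiftDeriv K) w (b (k + 1)) - evalAt (shiftDeriv K) u (b (k + 1))
        - MvPolynomial.C ξ *
          (evalAt (shiftDeriv K) w (b k) - evalAt (shiftDeriv K) u (b k)))
      + shiftDeriv K (shiftDeriv K (evalAt (shiftDeriv K) w (b k))
        + 2 * v * evalAt (shiftDeriv K) w (b k)) = 0 := by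
    intro k hk
    have e1 := hu4 k
    have e2 := hw4 k
    rw [hdu] at e1
    rw [hdw] at e2
    have hk1 := congrArg (shiftDeriv K) hk
    have hk2 := congrArg (shiftDeriv K) hk1
    -- Integration: the derivative vanishes by the difference of the two Lenard recursions, and the
    -- constant term vanishes by `hcc`.
    refine (eq_C_of_shiftDeriv_eq_zero _ ?_).trans ?_
    · refine two_mul_cancel K ?_
      simp only [map_add, map_sub, map_zero, Derivation.leibniz, h2, shiftDeriv_C,
        smul_eq_mul] at hk1 hk2 e1 e2 ⊢
      linear_combination e2 - e1 + hk2 + 2 * v * hk1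
        - 4 * shiftDeriv K (evalAt (shiftDeriv K) w (b k)) * hw
        + 4 * shiftDeriv K (evalAt (shiftDeriv K) u (b k)) * hu
    · simp [hcc, constantCoeff_shiftDeriv, hv]
  have first : ∀ k, shiftDeriv K (evalAt (shiftDeriv K) u (b k))
        - 2 * v * evalAt (shiftDeriv K) u (b k)
        + (shiftDeriv K (evalAt (shiftDeriv K) w (b k))
          + 2 * v * evalAt (shiftDeriv K) w (b k)) = 0 := by
    intro k
    induction k with
    | zero => simp [b]
    | succ k hk =>
      have e1 := hu4 k
      have e2 := hw4 k
      have e3 := second k hk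
      rw [hdu] at e1
      rw [hdw] at e2
      have hk1 := congrArg (shiftDeriv K) hk
      have hk2 := congrArg (shiftDeriv K) hk1
      -- The factor 4 matches the Lenard recursion. Here the sum of the two recursions enters, and
      -- the companion relation at `k` supplies the terms in `b_{k+1}`.
      refine two_mul_cancel K (two_mul_cancel K ?_)
      simp only [map_add, map_sub, map_zero, Derivation.leibniz, h2,
        smul_eq_mul] at hk1 hk2 e1 e2 e3 ⊢
      linear_combination e2 + e1 + 4 * v * e3 - hk2 - 2 * v * hk1 + 4 * MvPolynomial.C ξ * hk
        - 4 * shiftDeriv K (evalAt (shiftDeriv K) w (b k)) * hw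
        - 4 * shiftDeriv K (evalAt (shiftDeriv K) u (b k)) * hu
  exact ⟨first k, second k (first k)⟩

end Algebra

/-! ### Squared sources, and the evolution of the logarithmic derivative of a seed -/

section DifferentialAlgebra

variable {K R : Type*} [Field K] [CommRing R] [Algebra K R]

theorem deriv_two (d : Derivation K R R) : d (2 : R) = 0 := by
  rw [← map_ofNat (algebraMap K R) 2, Derivation.map_algebraMap]

/-- At `μ = l` this is the classical third order equation for the square of an eigenfunction.
Shifting the spectral parameter only adds a multiple of `∂ q²`. -/
theorem lenard_sq (d : Derivation K R R) {u q : R} {l : K}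
    (h : d (d q) + (algebraMap K R l + u) * q = 0) (μ : K) :
    -d (d (d (q ^ 2))) - 4 * (u + algebraMap K R μ) * d (q ^ 2) - 2 * d u * q ^ 2
      = 4 * (algebraMap K R l - algebraMap K R μ) * d (q ^ 2) := by
  have h' := congrArg d h
  simp only [pow_two, map_add, Derivation.leibniz, smul_eq_mul, Derivation.map_algebraMap,
    map_zero] at h' ⊢
  linear_combination -6 * d q * h - 2 * q * h'

theorem algebraMap_div_mul (α : K) {μ l : K} (h : μ ≠ l) :
    algebraMap K R (α / (μ - l)) * (algebraMap K R μ - algebraMap K R l) = algebraMap K R α := by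
  rw [← map_sub, ← map_mul, div_mul_cancel₀ _ (sub_ne_zero.mpr h)]

variable {d τ : Derivation K R R}

/-- The first order system satisfied by a source `q` and its Darboux transform `r`. -/
structure SourcePair (d : Derivation K R R) (v : R) (s : K) (q r : R) : Prop where
  fst : d q = v * q + algebraMap K R s * r
  snd : d r = -algebraMap K R s * q - v * r

/-- The two halves are `2 s q r` and `-2 s q r`. -/
theorem SourcePair.miura {v q r : R} {s : K} (h : SourcePair d v s q r) :
    d (q ^ 2) - 2 * v * q ^ 2 + (d (r ^ 2) + 2 * v * r ^ 2) = 0 := by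
  simp only [pow_two, Derivation.leibniz, smul_eq_mul, h.fst, h.snd]
  ring

/-- In `∂(q r)` the terms with `v` cancel, which leaves `s (r² - q²)`. -/
theorem SourcePair.deriv_miura {v q r : R} {s : K} (h : SourcePair d v s q r) :
    d (d (r ^ 2) + 2 * v * r ^ 2) = -2 * algebraMap K R (s ^ 2) * (r ^ 2 - q ^ 2) := by
  have h1 : d (r ^ 2) + 2 * v * r ^ 2 = -2 * (algebraMap K R s * (q * r)) := by
    simp only [pow_two, Derivation.leibniz, smul_eq_mul, h.snd]
    ring
  rw [h1]
  simp only [Derivation.leibniz, smul_eq_mul, h.fst, h.snd, Derivation.map_algebraMap, map_neg,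
    deriv_two d, map_pow]
  ring

theorem SourcePair.schrodinger {v w q r : R} {s ξ l : K} (h : SourcePair d v s q r)
    (hs : s ^ 2 = l - ξ) (hw : w = d v - v ^ 2 - algebraMap K R ξ) :
    d (d r) + (algebraMap K R l + w) * r = 0 := by
  have h2 := congrArg (algebraMap K R) hs
  rw [map_pow, map_sub] at h2
  rw [h.snd]
  simp only [map_sub, Derivation.leibniz, smul_eq_mul, map_neg, Derivation.map_algebraMap,
    h.fst, h.snd, hw]
  linear_combination -r * h2

/-- Evolution of the logarithmic derivative `v` of a seed `f`. -/
theorem evolution_logDeriv (hcomm : ∀ r, τ (d r) = d (τ r)) {f finv B : R} {η : K}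
    (hinv : f * finv = 1) (hv : d f = v * f)
    (hf : 2 * τ f = -d B * f + 2 * B * d f + 2 * algebraMap K R η * f) :
    2 * τ v = -d (d B - 2 * v * B) := by
  have h1 := hcomm f
  have h2 := congrArg d hf
  -- This is `v_t = ∂(f_t / f)` with `f_t / f = -½ B_x + v B + η`, cleared of denominators. The
  -- factor `f` is then removed with `finv`.
  have h3 : (2 * τ v + d (d B - 2 * v * B)) * f = 0 := by
    rw [hv] at h1 h2
    simp only [map_add, map_sub, map_neg, Derivation.leibniz, smul_eq_mul,
      Derivation.map_algebraMap, deriv_two d, hv] at h1 h2 ⊢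
    rw [hv] at hf
    linear_combination 2 * h1 + h2 - v * hf
  linear_combination finv * h3 - (2 * τ v + d (d B - 2 * v * B)) * hinv

end DifferentialAlgebra

/-! ### One Darboux step as a Miura transformation -/

section OneStep

variable {K R : Type*} [Field K] [CommRing R] [Algebra K R] [CharZero K]
  (d : Derivation K R R)

/-- The Miura relations between `b_k[-v_x - v² - ξ]` and `b_k[v_x - v² - ξ]`. -/
theorem miura_b {ξ : K} {v u w : R} (hu : u = -d v - v ^ 2 - algebraMap K R ξ)
    (hw : w = d v - v ^ 2 - algebraMap K R ξ) (k : ℕ) :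
    (d (evalAt d u (b k)) - 2 * v * evalAt d u (b k)
      + (d (evalAt d w (b k)) + 2 * v * evalAt d w (b k)) = 0)
    ∧ 2 * (evalAt d w (b (k + 1)) - evalAt d u (b (k + 1))
        - algebraMap K R ξ * (evalAt d w (b k) - evalAt d u (b k)))
      + d (d (evalAt d w (b k)) + 2 * v * evalAt d w (b k)) = 0 := by
  -- Substituting the derivatives of `v` transports the universal identity. A direct proof in `R`
  -- could not integrate: for functions of `(x, t)` the kernel of `d` contains all functions of `t`.
  let θ : MvPolynomial ℕ K →ₐ[K] R := MvPolynomial.aeval (fun i => d^[i] v)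
  have hθX : ∀ i, θ (MvPolynomial.X i) = d^[i] v := fun i => MvPolynomial.aeval_X _ _
  have hθ : ∀ r, θ (shiftDeriv K r) = d (θ r) := by
    intro r
    induction r using MvPolynomial.induction_on with
    | C c =>
      rw [shiftDeriv_C, map_zero, ← MvPolynomial.algebraMap_eq, AlgHom.commutes,
        Derivation.map_algebraMap]
    | add p q hp hq => simp only [map_add, hp, hq]
    | mul_X p j hp =>
      simp only [Derivation.leibniz, smul_eq_mul, map_add, map_mul, hp, shiftDeriv_X, hθX,
        Function.iterate_succ_apply']
  have hθC : θ (MvPolynomial.C ξ) = algebraMap K R ξ := by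
    rw [← MvPolynomial.algebraMap_eq, AlgHom.commutes]
  have hθv : θ (MvPolynomial.X 0) = v := hθX 0
  obtain ⟨h1, h2⟩ := miura_b_universal ξ (MvPolynomial.X 0) _ _ rfl rfl rfl k
  have h1' := congrArg θ h1
  have h2' := congrArg θ h2
  simp only [map_add, map_sub, map_neg, map_mul, map_pow, map_ofNat, map_zero, hθ, hθv, hθC,
    evalAt_map _ d θ hθ] at h1' h2'
  rw [← hu, ← hw] at h1' h2'
  exact ⟨h1', by rw [map_add]; exact h2'⟩

/-- `∑_{i ≤ M} b_i[u] μ^{M-i}`. -/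
noncomputable def bSum (u : R) (μ : K) (M : ℕ) : R :=
  ∑ i ∈ Finset.range (M + 1), algebraMap K R μ ^ (M - i) * evalAt d u (b i)

theorem bSum_zero (u : R) (μ : K) : bSum d u μ 0 = 0 := by
  simp [bSum, b]

theorem bSum_succ (u : R) (μ : K) (M : ℕ) :
    bSum d u μ (M + 1) = algebraMap K R μ * bSum d u μ M + evalAt d u (b (M + 1)) := by
  rw [bSum, Finset.sum_range_succ, Nat.sub_self, pow_zero, one_mul, bSum, Finset.mul_sum]
  congr 1
  refine Finset.sum_congr rfl fun i hi => ?_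
  rw [Nat.succ_sub (Nat.lt_succ_iff.mp (Finset.mem_range.mp hi)), pow_succ']
  ring

/-- The sum telescopes: by the recursion, the term `-4 μ ∂` cancels everything except the
contribution of the top index. -/
theorem lenard_bSum (u : R) (μ : K) (M : ℕ) :
    -d (d (d (bSum d u μ M))) - 4 * (u + algebraMap K R μ) * d (bSum d u μ M)
      - 2 * d u * bSum d u μ M = 4 * d (evalAt d u (b (M + 1))) := by
  induction M with
  | zero => simp [bSum_zero, b]
  | succ M ih =>
    rw [bSum_succ]
    simp only [map_add, Derivation.leibniz, smul_eq_mul, Derivation.map_algebraMap, mul_zero,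
      add_zero]
    linear_combination algebraMap K R μ * ih - four_mul_deriv_b_succ d u (M + 1)

theorem miura_bSum {ξ : K} {v u w : R} (hu : u = -d v - v ^ 2 - algebraMap K R ξ)
    (hw : w = d v - v ^ 2 - algebraMap K R ξ) (μ : K) (M : ℕ) :
    d (bSum d u μ M) - 2 * v * bSum d u μ M
      + (d (bSum d w μ M) + 2 * v * bSum d w μ M) = 0 := by
  induction M with
  | zero => simp [bSum_zero]
  | succ M ih =>
    rw [bSum_succ, bSum_succ]
    simp only [map_add, Derivation.leibniz, smul_eq_mul, Derivation.map_algebraMap, mul_zero,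
      add_zero]
    linear_combination algebraMap K R μ * ih + (miura_b d hu hw (M + 1)).1

/-- The companion Miura relation summed against powers of `μ`. The index shift `k + 1` turns the
factor `ξ` into the difference with `μ` and leaves one term at the top. -/
theorem deriv_miura_bSum {ξ : K} {v u w : R} (hu : u = -d v - v ^ 2 - algebraMap K R ξ)
    (hw : w = d v - v ^ 2 - algebraMap K R ξ) (μ : K) (M : ℕ) :
    d (d (bSum d w μ M) + 2 * v * bSum d w μ M)
      = -2 * (evalAt d w (b (M + 1)) - evalAt d u (b (M + 1)))
        - 2 * (algebraMap K R μ - algebraMap K R ξ) * (bSum d w μ M - bSum d u μ M) := by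
  induction M with
  | zero => simp [bSum_zero, b]
  | succ M ih =>
    have h2 := (miura_b d hu hw (M + 1)).2
    rw [bSum_succ, bSum_succ]
    simp only [map_add, Derivation.leibniz, smul_eq_mul, Derivation.map_algebraMap, mul_zero,
      add_zero] at ih h2 ⊢
    linear_combination algebraMap K R μ * ih + h2

variable {ι : Type*} [Fintype ι]

/-- The coefficient `B` of the linear problem in the form
`ψ_t = -½ B_x ψ + B ψ_x + η ψ`. -/
noncomputable def laxB (n : ℕ) (α : K) (lam : ι → K) (u : R) (φ : ι → R) (μ : K) : R :=
  bSum d u μ (n + 1) - ∑ j, algebraMap K R (α / (μ - lam j)) * φ j ^ 2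

/-- The weights `α / (μ - λ_j)` cancel the factors `λ_j - μ` from `lenard_sq`, so the right side no
longer depends on `μ`: it is `-2` times the right side of the equation with sources. -/
theorem lenard_laxB (n : ℕ) (α : K) {lam : ι → K} {u : R} {φ : ι → R}
    (hφ : ∀ j, d (d (φ j)) + (algebraMap K R (lam j) + u) * φ j = 0) {μ : K}
    (hμ : ∀ j, μ ≠ lam j) :
    -d (d (d (laxB d n α lam u φ μ))) - 4 * (u + algebraMap K R μ) * d (laxB d n α lam u φ μ)
      - 2 * d u * laxB d n α lam u φ μ
      = 4 * (d (evalAt d u (b (n + 2))) + algebraMap K R α * ∑ j, d (φ j ^ 2)) := by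
  have h1 := lenard_bSum d u μ (n + 1)
  have h2 : -d (d (d (∑ j, algebraMap K R (α / (μ - lam j)) * φ j ^ 2)))
      - 4 * (u + algebraMap K R μ) * d (∑ j, algebraMap K R (α / (μ - lam j)) * φ j ^ 2)
      - 2 * d u * (∑ j, algebraMap K R (α / (μ - lam j)) * φ j ^ 2)
      = -4 * (algebraMap K R α * ∑ j, d (φ j ^ 2)) := by
    simp only [map_sum, Finset.mul_sum, ← Finset.sum_neg_distrib, ← Finset.sum_sub_distrib]
    refine Finset.sum_congr rfl fun j _ => ?_
    have h3 := lenard_sq d (hφ j) μ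
    have h4 := algebraMap_div_mul (R := R) α (hμ j)
    generalize φ j ^ 2 = q at h3 ⊢
    simp only [Derivation.leibniz, smul_eq_mul, Derivation.map_algebraMap, mul_zero, add_zero]
    linear_combination algebraMap K R (α / (μ - lam j)) * h3 - 4 * d q * h4
  simp only [laxB, map_sub]
  linear_combination h1 - h2

variable {d} {n : ℕ} {α ξ : K} {lam s : ι → K} {v u w : R} {φ φ' : ι → R}

theorem miura_laxB (hu : u = -d v - v ^ 2 - algebraMap K R ξ)
    (hw : w = d v - v ^ 2 - algebraMap K R ξ) (hφ : ∀ j, SourcePair d v (s j) (φ j) (φ' j))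
    (μ : K) :
    d (laxB d n α lam u φ μ) - 2 * v * laxB d n α lam u φ μ
      + (d (laxB d n α lam w φ' μ) + 2 * v * laxB d n α lam w φ' μ) = 0 := by
  have h1 := miura_bSum d hu hw μ (n + 1)
  have h2 : d (∑ j, algebraMap K R (α / (μ - lam j)) * φ j ^ 2)
      - 2 * v * (∑ j, algebraMap K R (α / (μ - lam j)) * φ j ^ 2)
      + (d (∑ j, algebraMap K R (α / (μ - lam j)) * φ' j ^ 2)
      + 2 * v * (∑ j, algebraMap K R (α / (μ - lam j)) * φ' j ^ 2)) = 0 := by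
    simp only [map_sum, Finset.mul_sum, ← Finset.sum_sub_distrib, ← Finset.sum_add_distrib]
    refine Finset.sum_eq_zero fun j _ => ?_
    have h3 := (hφ j).miura
    rw [Derivation.leibniz, Derivation.leibniz]
    simp only [smul_eq_mul, Derivation.map_algebraMap]
    linear_combination algebraMap K R (α / (μ - lam j)) * h3
  simp only [laxB, map_sub]
  linear_combination h1 - h2

/-- For the sources, split `λ_j - ξ = (μ - ξ) - (μ - λ_j)`: the second part cancels the denominator
and gives the `μ`-free sum of squares. -/
theorem deriv_miura_laxB (hu : u = -d v - v ^ 2 - algebraMap K R ξ)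
    (hw : w = d v - v ^ 2 - algebraMap K R ξ) (hφ : ∀ j, SourcePair d v (s j) (φ j) (φ' j))
    (hs : ∀ j, s j ^ 2 = lam j - ξ) {μ : K} (hμ : ∀ j, μ ≠ lam j) :
    d (d (laxB d n α lam w φ' μ) + 2 * v * laxB d n α lam w φ' μ)
      = -2 * (evalAt d w (b (n + 2)) - evalAt d u (b (n + 2))
          + algebraMap K R α * ∑ j, (φ' j ^ 2 - φ j ^ 2))
        - 2 * (algebraMap K R μ - algebraMap K R ξ)
          * (laxB d n α lam w φ' μ - laxB d n α lam u φ μ) := by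
  have h1 := deriv_miura_bSum d hu hw μ (n + 1)
  have h2 : d (d (∑ j, algebraMap K R (α / (μ - lam j)) * φ' j ^ 2)
      + 2 * v * ∑ j, algebraMap K R (α / (μ - lam j)) * φ' j ^ 2)
      = 2 * (algebraMap K R α * ∑ j, (φ' j ^ 2 - φ j ^ 2))
        - 2 * (algebraMap K R μ - algebraMap K R ξ)
          * (∑ j, algebraMap K R (α / (μ - lam j)) * φ' j ^ 2
            - ∑ j, algebraMap K R (α / (μ - lam j)) * φ j ^ 2) := by
    simp only [map_sum, Finset.mul_sum, ← Finset.sum_sub_distrib, ← Finset.sum_add_distrib]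
    refine Finset.sum_congr rfl fun j _ => ?_
    have h3 := (hφ j).deriv_miura
    have h4 := algebraMap_div_mul (R := R) α (hμ j)
    rw [hs j, map_sub] at h3
    have h5 : d (algebraMap K R (α / (μ - lam j)) * φ' j ^ 2)
        + 2 * v * (algebraMap K R (α / (μ - lam j)) * φ' j ^ 2)
        = algebraMap K R (α / (μ - lam j)) * (d (φ' j ^ 2) + 2 * v * φ' j ^ 2) := by
      rw [Derivation.leibniz]
      simp only [smul_eq_mul, Derivation.map_algebraMap]
      ring
    rw [h5, Derivation.leibniz, h3]
    simp only [smul_eq_mul, Derivation.map_algebraMap]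
    linear_combination 2 * (φ' j ^ 2 - φ j ^ 2) * h4
  simp only [laxB, map_sub, map_add, Derivation.leibniz, smul_eq_mul] at h1 h2 ⊢
  linear_combination h1 - h2

variable {τ : Derivation K R R}

/-- The Darboux transform of the potential satisfies the equation with sources. -/
theorem evolution_potential (hcomm : ∀ r, τ (d r) = d (τ r))
    (hu : u = -d v - v ^ 2 - algebraMap K R ξ)
    (hw : w = d v - v ^ 2 - algebraMap K R ξ) (hφ : ∀ j, SourcePair d v (s j) (φ j) (φ' j))
    (hs : ∀ j, s j ^ 2 = lam j - ξ) (hξ : ∀ j, ξ ≠ lam j)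
    (hv : 2 * τ v = -d (d (laxB d n α lam u φ ξ) - 2 * v * laxB d n α lam u φ ξ)) :
    τ w = d (-2 * evalAt d w (b (n + 2)) - 2 * algebraMap K R α * ∑ j, φ' j ^ 2) := by
  have h1 := lenard_laxB d n α (fun j => (hφ j).schrodinger (hs j) hw) hξ
  have h2 := miura_laxB (n := n) (α := α) (lam := lam) hu hw hφ ξ
  -- The Miura relation trades the old data for the new.
  have h3 : 2 * τ v = d (d (laxB d n α lam w φ' ξ) + 2 * v * laxB d n α lam w φ' ξ) := by
    rw [hv, ← map_neg]; congr 1; linear_combination -h2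
  have h4 := congrArg d h3
  have h5 := congrArg τ hw
  have h6 := congrArg d hw
  -- Since `w_t = (∂ - 2v) v_t`, what remains is the factorization `(∂ - 2v) ∂ (∂ + 2v) = ∂³ + 4 (w
  -- + ξ) ∂ + 2 w_x`, applied to the new `B`, together with `h1`.
  refine two_mul_cancel K ?_
  generalize laxB d n α lam w φ' ξ = B at *
  simp only [map_add, map_sub, map_neg, Derivation.leibniz, smul_eq_mul, map_sum, pow_two, neg_mul,
    Derivation.map_algebraMap, deriv_two d, map_zero, hcomm] at h1 h3 h4 h5 h6 ⊢
  rw [h6] at h1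
  linear_combination 2 * h5 + h4 - 2 * v * h3 - h1 - 4 * d B * hw

/-- The Darboux transform of a solution of the linear problem. -/
theorem evolution_darboux (hcomm : ∀ r, τ (d r) = d (τ r))
    (hu : u = -d v - v ^ 2 - algebraMap K R ξ)
    (hw : w = d v - v ^ 2 - algebraMap K R ξ) (hφ : ∀ j, SourcePair d v (s j) (φ j) (φ' j))
    (hs : ∀ j, s j ^ 2 = lam j - ξ) (hξ : ∀ j, ξ ≠ lam j)
    (hv : 2 * τ v = -d (d (laxB d n α lam u φ ξ) - 2 * v * laxB d n α lam u φ ξ))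
    {μ η : K} (hμ : ∀ j, μ ≠ lam j) {ψ χ : R} (hχ : χ = d ψ - v * ψ)
    (hψ : d (d ψ) + (algebraMap K R μ + u) * ψ = 0)
    (hτ : 2 * τ ψ = -d (laxB d n α lam u φ μ) * ψ + 2 * laxB d n α lam u φ μ * d ψ
      + 2 * algebraMap K R η * ψ) :
    d (d χ) + (algebraMap K R μ + w) * χ = 0 ∧
    2 * τ χ = -d (laxB d n α lam w φ' μ) * χ + 2 * laxB d n α lam w φ' μ * d χ
      + 2 * algebraMap K R η * χ := by
  have hdχ : d χ = (algebraMap K R ξ - algebraMap K R μ) * ψ - v * χ := by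
    rw [hχ]
    simp only [map_sub, Derivation.leibniz, smul_eq_mul]
    linear_combination hψ - ψ * hu
  have hdψ : d ψ = χ + v * ψ := by rw [hχ]; ring
  constructor
  · rw [hdχ]
    simp only [map_sub, Derivation.leibniz, smul_eq_mul, Derivation.map_algebraMap]
    rw [hdχ, hdψ, hw]
    ring
  · have h1 := deriv_miura_laxB (n := n) (α := α) hu hw hφ hs hμ
    have h2 := deriv_miura_laxB (n := n) (α := α) hu hw hφ hs hξ
    have h3 := miura_laxB (n := n) (α := α) (lam := lam) hu hw hφ μ
    have h4 := miura_laxB (n := n) (α := α) (lam := lam) hu hw hφ ξ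
    have h5 : 2 * τ v = d (d (laxB d n α lam w φ' ξ) + 2 * v * laxB d n α lam w φ' ξ) := by
      rw [hv, ← map_neg]; congr 1; linear_combination -h4
    -- At `μ = ξ` the last term of `deriv_miura_laxB` drops out, so `2 v_t` is `-2` times the
    -- `μ`-free bracket. The same bracket occurs at general `μ` in `h8` and is eliminated there.
    rw [h2] at h5
    have h6 := congrArg τ hχ
    have h7 := congrArg d hτ
    have h8 := congrArg d h3
    rw [map_add, h1, map_zero] at h8
    generalize laxB d n α lam w φ' μ = B' at *
    generalize laxB d n α lam u φ μ = B at *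
    simp only [map_add, map_sub, map_neg, Derivation.leibniz, smul_eq_mul,
      Derivation.map_algebraMap, deriv_two d, hcomm] at h6 h7 h8
    simp only [hdχ, hdψ, map_add, Derivation.leibniz, smul_eq_mul] at h6 h7 hτ ⊢
    linear_combination 2 * h6 + h7 - v * hτ - ψ * h5 - ψ * h8 + χ * h3

end OneStep

/-! ### Crum's formula in a differential algebra -/

section Crum

variable {K R : Type*} [Field K] [CommRing R] [Algebra K R] (d : Derivation K R R)

/-- The composition of the first order operators `d - V i`. -/
noncomputable def operatorProd (V : ℕ → R) : ℕ → R → R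
  | 0, g => g
  | i + 1, g => d (operatorProd V i g) - V i * operatorProd V i g

theorem operatorProd_eq_zero (V : ℕ → R) {i m : ℕ} (h : i ≤ m) {g : R}
    (hg : operatorProd d V i g = 0) : operatorProd d V m g = 0 := by
  induction m, h using Nat.le_induction with
  | base => exact hg
  | succ m _ ih => simp [operatorProd, ih]

theorem exists_operatorProd_eq_sum (V : ℕ → R) (m : ℕ) :
    ∃ c : ℕ → R, c m = 1 ∧ (∀ k, m < k → c k = 0) ∧
      ∀ g, operatorProd d V m g = ∑ k ∈ Finset.range (m + 1), c k * d^[k] g := by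
  induction m with
  | zero =>
    exact ⟨fun k => if k = 0 then 1 else 0, by simp, fun k hk => by simp [hk.ne'],
      fun g => by simp [operatorProd]⟩
  | succ m ih =>
    obtain ⟨c, hc1, hc0, hc⟩ := ih
    -- The coefficients of `(∂ - V m) ∘ ∑ c_k ∂^k`. Having `c k = 0` above the order removes the
    -- extra term when the sums are reindexed.
    refine ⟨fun k => (if k = 0 then 0 else c (k - 1)) + (d (c k) - V m * c k), ?_, ?_, ?_⟩
    · simp [hc1, hc0]
    · intro k hk
      have h1 : k ≠ 0 := by omega
      simp [h1, hc0 k (by omega), hc0 (k - 1) (by omega)]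
    · intro g
      simp only [add_mul, Finset.sum_add_distrib]
      rw [Finset.sum_range_succ', Finset.sum_range_succ _ (m + 1), hc0 (m + 1) (by omega)]
      simp only [operatorProd, hc, map_sum, Finset.mul_sum, Nat.add_sub_cancel, map_zero, mul_zero,
        sub_zero, zero_mul, add_zero, Nat.add_eq_zero_iff, one_ne_zero, and_false, if_false,
        if_true, ← Finset.sum_add_distrib, ← Finset.sum_sub_distrib]
      refine Finset.sum_congr rfl fun k _ => ?_
      rw [Derivation.leibniz, Function.iterate_succ_apply']
      simp only [smul_eq_mul]
      ring

/-- The Wronskian in a differential algebra. -/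
noncomputable def ringWronskian {k : ℕ} (g : Fin k → R) : R :=
  Matrix.det (Matrix.of fun i j : Fin k => d^[(i : ℕ)] (g j))

/-- Crum's formula: if the product of first order operators annihilates `f 0, …, f (m - 1)`, then
it is the quotient of two Wronskians. -/
theorem ringWronskian_snoc (V : ℕ → R) {m : ℕ} (f : Fin m → R)
    (hf : ∀ i, operatorProd d V m (f i) = 0) (g : R) :
    ringWronskian d (Fin.snoc (α := fun _ => R) f g)
      = ringWronskian d f * operatorProd d V m g := by
  obtain ⟨c, hc1, -, hc⟩ := exists_operatorProd_eq_sum d V m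
  let A : Matrix (Fin (m + 1)) (Fin (m + 1)) R :=
    Matrix.of fun i j => d^[(i : ℕ)] (Fin.snoc (α := fun _ => R) f g j)
  -- Replacing the last row by the combination of all rows with coefficients `c k` multiplies the
  -- determinant by `c m = 1`. The new row is the operator applied to each column's function, so
  -- only its last entry survives.
  have h1 := Matrix.det_updateRow_sum A (Fin.last m) (fun k => c k)
  have hrow : ∀ j, (∑ k : Fin (m + 1), c k • A k) j
      = operatorProd d V m (Fin.snoc (α := fun _ => R) f g j) := by
    intro j
    rw [hc, Finset.sum_apply, Finset.sum_range (fun k => c k * d^[k] _)]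
    rfl
  have hlast : (Fin.last m : Fin (m + 1)).succAbove = Fin.castSucc := Fin.succAbove_last
  rw [Fin.val_last, hc1, one_smul, Matrix.det_succ_row _ (Fin.last m), Fin.sum_univ_castSucc,
    Finset.sum_eq_zero, zero_add] at h1
  · rw [Matrix.updateRow_self, hrow, Fin.snoc_last, Even.neg_one_pow ⟨m, by simp⟩, one_mul,
      hlast] at h1
    change A.det = _
    rw [← h1, mul_comm, ringWronskian]
    congr 2
    ext i j
    simp [Matrix.updateRow_ne, A]
  · intro j _
    rw [Matrix.updateRow_self, hrow, Fin.snoc_castSucc, hf, mul_zero, zero_mul]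

end Crum

/-! ### The differential algebra of smooth functions of `(x, t)` -/

section SmoothFunctions

variable {𝕜 : Type*} [RCLike 𝕜]

variable (𝕜) in
/-- The algebra of smooth functions of `(x, t)`. -/
def smoothFun : Subalgebra 𝕜 (ℝ → ℝ → 𝕜) where
  carrier := {g | Smooth g}
  mul_mem' {a b} (ha : Smooth a) (hb : Smooth b) := (ContDiff.mul ha hb : Smooth (a * b))
  add_mem' {a b} (ha : Smooth a) (hb : Smooth b) := (ContDiff.add ha hb : Smooth (a + b))
  algebraMap_mem' c := (contDiff_const : ContDiff ℝ ∞ fun _ : ℝ × ℝ => c)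

theorem Smooth.hasDerivAt_fst {g : ℝ → ℝ → 𝕜} (hg : Smooth g) (x t : ℝ) :
    HasDerivAt (fun y => g y t) (fderiv ℝ (fun p : ℝ × ℝ => g p.1 p.2) (x, t) (1, 0)) x := by
  have h1 := (ContDiff.differentiable hg (by simp) (x, t)).hasFDerivAt
  have h2 : HasDerivAt (fun y : ℝ => (y, t)) (1, 0) x :=
    (hasDerivAt_id x).prodMk (hasDerivAt_const x t)
  exact h1.comp_hasDerivAt x h2

theorem Smooth.hasDerivAt_snd {g : ℝ → ℝ → 𝕜} (hg : Smooth g) (x t : ℝ) :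
    HasDerivAt (fun r => g x r) (fderiv ℝ (fun p : ℝ × ℝ => g p.1 p.2) (x, t) (0, 1)) t := by
  have h1 := (ContDiff.differentiable hg (by simp) (x, t)).hasFDerivAt
  have h2 : HasDerivAt (fun r : ℝ => (x, r)) (0, 1) t :=
    (hasDerivAt_const t x).prodMk (hasDerivAt_id t)
  exact h1.comp_hasDerivAt t h2

theorem Smooth.dx_eq {g : ℝ → ℝ → 𝕜} (hg : Smooth g) (x t : ℝ) :
    dx g x t = fderiv ℝ (fun p : ℝ × ℝ => g p.1 p.2) (x, t) (1, 0) :=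
  (hg.hasDerivAt_fst x t).deriv

theorem Smooth.dt_eq {g : ℝ → ℝ → 𝕜} (hg : Smooth g) (x t : ℝ) :
    dt g x t = fderiv ℝ (fun p : ℝ × ℝ => g p.1 p.2) (x, t) (0, 1) :=
  (hg.hasDerivAt_snd x t).deriv

theorem Smooth.hasDerivAt_dx {g : ℝ → ℝ → 𝕜} (hg : Smooth g) (x t : ℝ) :
    HasDerivAt (fun y => g y t) (dx g x t) x := by
  rw [hg.dx_eq]; exact hg.hasDerivAt_fst x t

theorem Smooth.hasDerivAt_dt {g : ℝ → ℝ → 𝕜} (hg : Smooth g) (x t : ℝ) :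
    HasDerivAt (fun r => g x r) (dt g x t) t := by
  rw [hg.dt_eq]; exact hg.hasDerivAt_snd x t

theorem Smooth.dx {g : ℝ → ℝ → 𝕜} (hg : Smooth g) : Smooth (dx g) := by
  have h : (fun p : ℝ × ℝ => KdVSource.dx g p.1 p.2)
      = fun p => fderiv ℝ (fun p : ℝ × ℝ => g p.1 p.2) p (1, 0) :=
    funext fun p => hg.dx_eq p.1 p.2
  rw [Smooth, h]
  exact (ContDiff.fderiv_right hg (m := ∞) (by simp)).clm_apply contDiff_const

theorem Smooth.dt {g : ℝ → ℝ → 𝕜} (hg : Smooth g) : Smooth (dt g) := by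
  have h : (fun p : ℝ × ℝ => KdVSource.dt g p.1 p.2)
      = fun p => fderiv ℝ (fun p : ℝ × ℝ => g p.1 p.2) p (0, 1) :=
    funext fun p => hg.dt_eq p.1 p.2
  rw [Smooth, h]
  exact (ContDiff.fderiv_right hg (m := ∞) (by simp)).clm_apply contDiff_const

theorem Smooth.dt_dx {g : ℝ → ℝ → 𝕜} (hg : Smooth g) (x t : ℝ) :
    KdVSource.dt (KdVSource.dx g) x t = KdVSource.dx (KdVSource.dt g) x t := by
  have hd : Differentiable ℝ (fderiv ℝ (fun p : ℝ × ℝ => g p.1 p.2)) :=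
    (ContDiff.fderiv_right hg (m := ∞) (by simp)).differentiable (by simp)
  have h1 : (fun p : ℝ × ℝ => KdVSource.dx g p.1 p.2)
      = fun p => fderiv ℝ (fun p : ℝ × ℝ => g p.1 p.2) p (1, 0) :=
    funext fun p => hg.dx_eq p.1 p.2
  have h2 : (fun p : ℝ × ℝ => KdVSource.dt g p.1 p.2)
      = fun p => fderiv ℝ (fun p : ℝ × ℝ => g p.1 p.2) p (0, 1) :=
    funext fun p => hg.dt_eq p.1 p.2
  rw [hg.dx.dt_eq, hg.dt.dx_eq, h1, h2, fderiv_clm_apply (hd _) (differentiableAt_const _),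
    fderiv_clm_apply (hd _) (differentiableAt_const _)]
  have hsymm : IsSymmSndFDerivAt ℝ (fun p : ℝ × ℝ => g p.1 p.2) (x, t) :=
    ContDiffAt.isSymmSndFDerivAt (ContDiff.contDiffAt hg) (by
      rw [minSmoothness_of_isRCLikeNormedField]; exact WithTop.coe_le_coe.mpr (le_top : (2 : ℕ∞) ≤ ⊤))
  simpa using hsymm (0, 1) (1, 0)

variable (𝕜) in
/-- `∂` as a derivation. -/
noncomputable def derivX : Derivation 𝕜 (smoothFun 𝕜) (smoothFun 𝕜) :=
  Derivation.mk'
    { toFun := fun g => ⟨dx g.1, Smooth.dx g.2⟩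
      map_add' := fun g h => Subtype.ext <| funext fun x => funext fun t =>
        ((Smooth.hasDerivAt_dx g.2 x t).add (Smooth.hasDerivAt_dx h.2 x t)).deriv
      map_smul' := fun c g => Subtype.ext <| funext fun x => funext fun t =>
        ((Smooth.hasDerivAt_dx g.2 x t).const_mul c).deriv }
    fun g h => Subtype.ext <| funext fun x => funext fun t => by
      refine ((Smooth.hasDerivAt_dx g.2 x t).mul (Smooth.hasDerivAt_dx h.2 x t)).deriv.trans ?_
      change _ = g.1 x t * dx h.1 x t + h.1 x t * dx g.1 x t
      ring

variable (𝕜) in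
/-- `∂_t` as a derivation. -/
noncomputable def derivT : Derivation 𝕜 (smoothFun 𝕜) (smoothFun 𝕜) :=
  Derivation.mk'
    { toFun := fun g => ⟨dt g.1, Smooth.dt g.2⟩
      map_add' := fun g h => Subtype.ext <| funext fun x => funext fun t =>
        ((Smooth.hasDerivAt_dt g.2 x t).add (Smooth.hasDerivAt_dt h.2 x t)).deriv
      map_smul' := fun c g => Subtype.ext <| funext fun x => funext fun t =>
        ((Smooth.hasDerivAt_dt g.2 x t).const_mul c).deriv }
    fun g h => Subtype.ext <| funext fun x => funext fun t => by
      refine ((Smooth.hasDerivAt_dt g.2 x t).mul (Smooth.hasDerivAt_dt h.2 x t)).deriv.trans ?_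
      change _ = g.1 x t * dt h.1 x t + h.1 x t * dt g.1 x t
      ring

theorem derivT_derivX (g : smoothFun 𝕜) : derivT 𝕜 (derivX 𝕜 g) = derivX 𝕜 (derivT 𝕜 g) :=
  Subtype.ext <| funext fun x => funext fun t => Smooth.dt_dx g.2 x t

/-- Evaluation at a point. -/
noncomputable def evalPt (x t : ℝ) : smoothFun 𝕜 →ₐ[𝕜] 𝕜 :=
  ((Pi.evalAlgHom 𝕜 (fun _ : ℝ => 𝕜) t).comp
    (Pi.evalAlgHom 𝕜 (fun _ : ℝ => ℝ → 𝕜) x)).comp (smoothFun 𝕜).val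

theorem evalPt_apply (x t : ℝ) (g : smoothFun 𝕜) : evalPt x t g = g.1 x t := rfl

theorem evalPt_derivX (x t : ℝ) (g : smoothFun 𝕜) : evalPt x t (derivX 𝕜 g) = dx g.1 x t := rfl

theorem evalPt_derivT (x t : ℝ) (g : smoothFun 𝕜) : evalPt x t (derivT 𝕜 g) = dt g.1 x t := rfl

theorem evalPt_algebraMap (x t : ℝ) (c : 𝕜) : evalPt x t (algebraMap 𝕜 (smoothFun 𝕜) c) = c := rfl

theorem ext_evalPt {g h : smoothFun 𝕜} (H : ∀ x t, evalPt x t g = evalPt x t h) : g = h :=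
  Subtype.ext <| funext fun x => funext fun t => H x t

theorem iteratedDeriv_eq_evalPt (g : smoothFun 𝕜) (i : ℕ) (x t : ℝ) :
    iteratedDeriv i (fun y => g.1 y t) x = evalPt x t ((derivX 𝕜)^[i] g) := by
  induction i generalizing x with
  | zero => simp [evalPt_apply]
  | succ i ih =>
    rw [iteratedDeriv_succ, Function.iterate_succ_apply', evalPt_derivX, dx]
    congr 1
    exact funext fun y => ih y

theorem evalDiff_eq_evalPt (g : smoothFun 𝕜) (P : DiffPoly) (x t : ℝ) :
    evalDiff P g.1 x t = evalPt x t (evalAt (derivX 𝕜) g P) := by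
  simp only [evalDiff, iteratedDeriv_eq_evalPt]
  induction P using MvPolynomial.induction_on with
  | C c =>
    rw [evalAt_C, evalPt_algebraMap, MvPolynomial.aeval_C]
    simp
  | add p q hp hq => simp only [map_add, hp, hq]
  | mul_X p j hp => simp only [map_mul, hp, evalAt_X, MvPolynomial.aeval_X]

theorem wronskian_eq_evalPt {k : ℕ} (g : Fin k → smoothFun 𝕜) (x t : ℝ) :
    wronskian (fun j => (g j).1) x t = evalPt x t (ringWronskian (derivX 𝕜) g) := by
  rw [wronskian, ringWronskian, AlgHom.map_det]
  congr 1
  ext i j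
  exact iteratedDeriv_eq_evalPt (g j) i x t

end SmoothFunctions

/-! ### One Darboux transformation -/

section DarbouxStep

variable {𝕜 : Type*} [RCLike 𝕜]

theorem two_mul_opA (n : ℕ) (U Ψ : smoothFun 𝕜) (μ : 𝕜) (x t : ℝ) :
    2 * opA n U.1 μ Ψ.1 x t = evalPt x t (-derivX 𝕜 (bSum (derivX 𝕜) U μ (n + 1)) * Ψ
      + 2 * bSum (derivX 𝕜) U μ (n + 1) * derivX 𝕜 Ψ) := by
  have ha : ∀ i, evalAt (derivX 𝕜) U (a i)
      = -algebraMap 𝕜 _ (1 / 2) * derivX 𝕜 (evalAt (derivX 𝕜) U (b i)) := by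
    intro i
    rw [a, map_mul, map_neg, evalAt_C, evalAt_D]
    push_cast
    rfl
  simp only [opA, bSum, map_sum, Finset.mul_sum, Finset.sum_mul, map_add, map_mul, map_neg,
    ← Finset.sum_add_distrib, ← Finset.sum_neg_distrib, evalDiff_eq_evalPt, ha,
    Derivation.leibniz, Derivation.leibniz_pow, Derivation.map_algebraMap, smul_eq_mul, smul_zero,
    mul_zero, add_zero, map_pow, evalPt_algebraMap, map_ofNat]
  refine Finset.sum_congr rfl fun i _ => ?_
  rw [← evalPt_derivX x t Ψ, ← evalPt_apply x t Ψ]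
  ring

/-- As `φ (φ_x ψ - φ ψ_x) = ½ (φ²)_x ψ - φ² ψ_x`, the source terms have the same shape as `A⁽ⁿ⁾ ψ`
and can be absorbed into `B`. -/
theorem isLocalLaxSolution_iff (n : ℕ) {N : ℕ} (α η : 𝕜) (lam : Fin N → 𝕜) (U : smoothFun 𝕜)
    (Φ : Fin N → smoothFun 𝕜) (μ : 𝕜) (Ψ : smoothFun 𝕜) :
    IsLocalLaxSolution n α η lam U.1 (fun j => (Φ j).1) μ Ψ.1 ↔
      derivX 𝕜 (derivX 𝕜 Ψ) + (algebraMap 𝕜 _ μ + U) * Ψ = 0 ∧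
      2 * derivT 𝕜 Ψ = -derivX 𝕜 (laxB (derivX 𝕜) n α lam U Φ μ) * Ψ
        + 2 * laxB (derivX 𝕜) n α lam U Φ μ * derivX 𝕜 Ψ + 2 * algebraMap 𝕜 _ η * Ψ := by
  have hev : ∀ x t, 2 * (opA n U.1 μ Ψ.1 x t + η * Ψ.1 x t + α * ∑ j, 1 / (μ - lam j) *
        ((Φ j).1 x t * (dx (Φ j).1 x t * Ψ.1 x t - (Φ j).1 x t * dx Ψ.1 x t)))
      = evalPt x t (-derivX 𝕜 (laxB (derivX 𝕜) n α lam U Φ μ) * Ψ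
        + 2 * laxB (derivX 𝕜) n α lam U Φ μ * derivX 𝕜 Ψ + 2 * algebraMap 𝕜 _ η * Ψ) := by
    intro x t
    have h1 : 2 * (α * ∑ j, 1 / (μ - lam j) *
        ((Φ j).1 x t * (dx (Φ j).1 x t * Ψ.1 x t - (Φ j).1 x t * dx Ψ.1 x t)))
      = evalPt x t (derivX 𝕜 (∑ j, algebraMap 𝕜 _ (α / (μ - lam j)) * Φ j ^ 2) * Ψ
        - 2 * (∑ j, algebraMap 𝕜 _ (α / (μ - lam j)) * Φ j ^ 2) * derivX 𝕜 Ψ) := by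
      simp only [map_sum, Finset.mul_sum, Finset.sum_mul, map_sub, map_add, map_mul, pow_two,
        ← Finset.sum_sub_distrib, Derivation.leibniz, Derivation.map_algebraMap, smul_eq_mul,
        mul_zero, add_zero, evalPt_algebraMap, map_ofNat]
      refine Finset.sum_congr rfl fun j _ => ?_
      simp only [evalPt_derivX]
      simp only [evalPt_apply]
      ring
    rw [mul_add, mul_add, two_mul_opA, h1]
    simp only [laxB, map_sub, map_add, map_mul, map_neg, evalPt_algebraMap, map_ofNat]
    rw [evalPt_apply x t Ψ]
    ring
  constructor
  · intro h
    refine ⟨ext_evalPt fun x t => h.schrodinger x t, ext_evalPt fun x t => ?_⟩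
    rw [← hev, map_mul, map_ofNat, evalPt_derivT, h.evolution]
  · rintro ⟨h1, h2⟩
    refine ⟨Ψ.2, fun x t => congrArg (evalPt x t) h1, fun x t => ?_⟩
    have h3 := congrArg (evalPt x t) h2
    rw [← hev, map_mul, map_ofNat, evalPt_derivT] at h3
    exact mul_left_cancel₀ two_ne_zero h3

theorem isSourceSolution_iff (n : ℕ) {N : ℕ} (α : 𝕜) (lam : Fin N → 𝕜) (U : smoothFun 𝕜)
    (Φ : Fin N → smoothFun 𝕜) :
    IsSourceSolution n α lam U.1 (fun j => (Φ j).1) ↔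
      derivT 𝕜 U = derivX 𝕜 (-2 * evalAt (derivX 𝕜) U (b (n + 2))
        - 2 * algebraMap 𝕜 _ α * ∑ j, Φ j ^ 2) ∧
      ∀ j, derivX 𝕜 (derivX 𝕜 (Φ j)) + (algebraMap 𝕜 _ (lam j) + U) * Φ j = 0 := by
  have hfun : (fun x t => -2 * evalDiff (b (n + 2)) U.1 x t - 2 * α * ∑ j, (Φ j).1 x t ^ 2)
      = (-2 * evalAt (derivX 𝕜) U (b (n + 2)) - 2 * algebraMap 𝕜 _ α * ∑ j, Φ j ^ 2 :
        smoothFun 𝕜).1 := by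
    funext x t
    rw [← evalPt_apply]
    simp only [map_sub, map_mul, map_neg, map_ofNat, map_sum, map_pow, evalPt_algebraMap,
      evalDiff_eq_evalPt]
    rfl
  constructor
  · intro h
    refine ⟨ext_evalPt fun x t => ?_, fun j => ext_evalPt fun x t => h.spectral j x t⟩
    rw [evalPt_derivT, h.evolution, hfun, evalPt_derivX]
  · rintro ⟨h1, h2⟩
    refine ⟨U.2, fun j => (Φ j).2, fun x t => ?_, fun j x t => congrArg (evalPt x t) (h2 j)⟩
    rw [hfun, ← evalPt_derivT, ← evalPt_derivX, h1]

theorem Smooth.inv {f : ℝ → ℝ → 𝕜} (hf : Smooth f) (hne : ∀ x t, f x t ≠ 0) :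
    Smooth fun x t => (f x t)⁻¹ :=
  ContDiff.inv hf fun p => hne p.1 p.2

theorem Smooth.darboux {f g : ℝ → ℝ → 𝕜} (hf : Smooth f) (hne : ∀ x t, f x t ≠ 0)
    (hg : Smooth g) : Smooth (darboux f g) := by
  simp only [Smooth, KdVSource.darboux, div_eq_mul_inv]
  exact ContDiff.sub hg.dx (ContDiff.mul (ContDiff.mul hf.dx (hf.inv hne)) hg)

/-- The Darboux transformation with seed `f` maps solutions of the equation with sources to
solutions, and likewise for the linear problem in its integral-free form. -/
theorem darboux_isSourceSolution_and_isLocalLaxSolution {n N : ℕ} {α η : 𝕜} {lam : Fin N → 𝕜}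
    {u : ℝ → ℝ → 𝕜} {φ : Fin N → ℝ → ℝ → 𝕜} (hsol : IsSourceSolution n α lam u φ) {ξ : 𝕜}
    {f : ℝ → ℝ → 𝕜} (hf : IsLocalLaxSolution n α η lam u φ ξ f) (hne : ∀ x t, f x t ≠ 0)
    (hξ : ∀ j, ξ ≠ lam j) {s : Fin N → 𝕜} (hs : ∀ j, s j ^ 2 = lam j - ξ) :
    IsSourceSolution n α lam (fun x t => u x t + 2 * d2log f x t)
      (fun j x t => 1 / s j * darboux f (φ j) x t) ∧
    ∀ μ ψ, (∀ j, μ ≠ lam j) → IsLocalLaxSolution n α η lam u φ μ ψ →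
      IsLocalLaxSolution n α η lam (fun x t => u x t + 2 * d2log f x t)
        (fun j x t => 1 / s j * darboux f (φ j) x t) μ (darboux f ψ) := by
  let U : smoothFun 𝕜 := ⟨u, hsol.smooth_u⟩
  let Φ : Fin N → smoothFun 𝕜 := fun j => ⟨φ j, hsol.smooth_φ j⟩
  let F : smoothFun 𝕜 := ⟨f, hf.smooth⟩
  let G : smoothFun 𝕜 := ⟨fun x t => (f x t)⁻¹, hf.smooth.inv hne⟩
  have hFG : F * G = 1 := ext_evalPt fun x t => mul_inv_cancel₀ (hne x t)
  let v : smoothFun 𝕜 := derivX 𝕜 F * G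
  have hdF : derivX 𝕜 F = v * F := by
    change derivX 𝕜 F = derivX 𝕜 F * G * F
    linear_combination (-derivX 𝕜 F) * hFG
  let w : smoothFun 𝕜 := U + 2 * derivX 𝕜 v
  let Φ' : Fin N → smoothFun 𝕜 :=
    fun j => algebraMap 𝕜 _ (1 / s j) * (derivX 𝕜 (Φ j) - v * Φ j)
  have hv_coe : (fun x t => dx f x t / f x t) = v.1 :=
    funext fun x => funext fun t => div_eq_mul_inv _ _
  have hdarb : ∀ g : smoothFun 𝕜, darboux f g.1 = (derivX 𝕜 g - v * g).1 := by
    intro g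
    funext x t
    rw [darboux, div_eq_mul_inv]
    rfl
  have hw_coe : (fun x t => u x t + 2 * d2log f x t) = w.1 := by
    rw [d2log, hv_coe]
    rfl
  have hΦ'_coe : (fun j x t => 1 / s j * darboux f (φ j) x t) = fun j => (Φ' j).1 := by
    funext j x t
    rw [show φ j = (Φ j).1 from rfl, hdarb]
    rfl
  obtain ⟨-, hφ⟩ := (isSourceSolution_iff n α lam U Φ).mp hsol
  obtain ⟨hf1, hf2⟩ := (isLocalLaxSolution_iff n α η lam U Φ ξ F).mp hf
  -- The Riccati form of the Schrödinger equation of the seed.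
  have hu : U = -derivX 𝕜 v - v ^ 2 - algebraMap 𝕜 _ ξ := by
    have h1 := congrArg (derivX 𝕜) hdF
    rw [Derivation.leibniz, hdF] at h1
    simp only [smul_eq_mul] at h1
    have h2 : (U + derivX 𝕜 v + v ^ 2 + algebraMap 𝕜 _ ξ) * F = 0 := by
      rw [hdF] at hf1
      linear_combination hf1 - h1
    linear_combination G * h2 - (U + derivX 𝕜 v + v ^ 2 + algebraMap 𝕜 _ ξ) * hFG
  have hw : w = derivX 𝕜 v - v ^ 2 - algebraMap 𝕜 _ ξ := by
    change U + 2 * derivX 𝕜 v = _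
    linear_combination hu
  have hs0 : ∀ j, s j ≠ 0 := by
    intro j h
    have := hs j
    rw [h, zero_pow two_ne_zero] at this
    exact hξ j (sub_eq_zero.mp this.symm).symm
  -- By the Riccati equation `(∂ + v)(∂ - v) = ∂² + u + ξ`, which acts on `φ_j` as `ξ - λ_j =
  -- -s_j²`. Dividing by `s_j` makes the system skew.
  have hpair : ∀ j, SourcePair (derivX 𝕜) v (s j) (Φ j) (Φ' j) := by
    intro j
    have h1 : algebraMap 𝕜 (smoothFun 𝕜) (s j) * algebraMap 𝕜 _ (1 / s j) = 1 := by
      rw [← map_mul, mul_one_div_cancel (hs0 j), map_one]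
    have h2 := congrArg (algebraMap 𝕜 (smoothFun 𝕜)) (hs j)
    rw [map_pow, map_sub] at h2
    constructor
    · change _ = _ + algebraMap 𝕜 _ (s j) *
        (algebraMap 𝕜 _ (1 / s j) * (derivX 𝕜 (Φ j) - v * Φ j))
      linear_combination (v * Φ j - derivX 𝕜 (Φ j)) * h1
    · change derivX 𝕜 (algebraMap 𝕜 _ (1 / s j) * (derivX 𝕜 (Φ j) - v * Φ j)) = _ - v *
        (algebraMap 𝕜 _ (1 / s j) * (derivX 𝕜 (Φ j) - v * Φ j))
      simp only [Derivation.leibniz, map_sub, Derivation.map_algebraMap, smul_eq_mul]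
      linear_combination algebraMap 𝕜 _ (1 / s j) * (hφ j - Φ j * hu + Φ j * h2)
        - Φ j * algebraMap 𝕜 _ (s j) * h1
  have hv := evolution_logDeriv derivT_derivX hFG hdF hf2
  rw [hw_coe, hΦ'_coe]
  refine ⟨(isSourceSolution_iff n α lam w Φ').mpr
    ⟨evolution_potential derivT_derivX hu hw hpair hs hξ hv,
      fun j => (hpair j).schrodinger (hs j) hw⟩, fun μ ψ hμ hψ => ?_⟩
  let Ψ : smoothFun 𝕜 := ⟨ψ, hψ.smooth⟩
  obtain ⟨hψ1, hψ2⟩ := (isLocalLaxSolution_iff n α η lam U Φ μ Ψ).mp hψ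
  rw [show ψ = Ψ.1 from rfl, hdarb]
  exact (isLocalLaxSolution_iff n α η lam w Φ' μ (derivX 𝕜 Ψ - v * Ψ)).mpr
    (evolution_darboux derivT_derivX hu hw hpair hs hξ hv hμ rfl hψ1 hψ2)

end DarbouxStep

/-! ### Repeated Darboux transformations -/

section Iteration

variable {𝕜 : Type*} [RCLike 𝕜]

theorem Smooth.iter {f : ℕ → ℝ → ℝ → 𝕜} {m : ℕ} (hf : ∀ i < m, Smooth (f i))
    (hne : ∀ i < m, ∀ x t, iter f i (f i) x t ≠ 0) {i : ℕ} (hi : i ≤ m) {g : ℝ → ℝ → 𝕜}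
    (hg : Smooth g) : Smooth (iter f i g) := by
  induction i generalizing g with
  | zero => exact hg
  | succ i ih => exact (ih (by omega) (hf i hi)).darboux (hne i hi) (ih (by omega) hg)

theorem exists_iter_eq_operatorProd {f : ℕ → ℝ → ℝ → 𝕜} {m : ℕ} (hf : ∀ i < m, Smooth (f i))
    (hne : ∀ i < m, ∀ x t, iter f i (f i) x t ≠ 0) :
    ∃ V : ℕ → smoothFun 𝕜, ∀ i ≤ m, ∀ g : smoothFun 𝕜,
      iter f i g.1 = (operatorProd (derivX 𝕜) V i g).1 := by
  have hF : ∀ i < m, Smooth (KdVSource.iter f i (f i)) :=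
    fun i hi => Smooth.iter hf hne hi.le (hf i hi)
  -- For `i ≥ m` nothing keeps the seed from vanishing, hence the default value `0`; it is never
  -- used.
  let V : ℕ → smoothFun 𝕜 := fun i => if h : i < m then
    ⟨fun x t => dx (iter f i (f i)) x t * (iter f i (f i) x t)⁻¹,
      ContDiff.mul (hF i h).dx ((hF i h).inv (hne i h))⟩ else 0
  refine ⟨V, fun i => ?_⟩
  induction i with
  | zero => exact fun _ _ => rfl
  | succ i ih =>
    intro hi g
    have hV : V i = ⟨fun x t => dx (iter f i (f i)) x t * (iter f i (f i) x t)⁻¹,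
        ContDiff.mul (hF i hi).dx ((hF i hi).inv (hne i hi))⟩ := dif_pos hi
    funext x t
    rw [KdVSource.iter, KdVSource.darboux, ih (by omega) g, operatorProd, hV, div_eq_mul_inv]
    rfl

/-- Crum's formula for the repeated Darboux transformation. -/
theorem wronskian_snoc {f : ℕ → ℝ → ℝ → 𝕜} {m : ℕ} (hf : ∀ i < m, Smooth (f i))
    (hne : ∀ i < m, ∀ x t, iter f i (f i) x t ≠ 0) {g : ℝ → ℝ → 𝕜} (hg : Smooth g) (x t : ℝ) :
    wronskian (Fin.snoc (α := fun _ => ℝ → ℝ → 𝕜) (fun i : Fin m => f i) g) x t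
      = wronskian (fun i : Fin m => f i) x t * iter f m g x t := by
  obtain ⟨V, hV⟩ := exists_iter_eq_operatorProd hf hne
  let F : Fin m → smoothFun 𝕜 := fun i => ⟨f i, hf i i.2⟩
  let G : smoothFun 𝕜 := ⟨g, hg⟩
  have hkill : ∀ i, operatorProd (derivX 𝕜) V m (F i) = 0 := by
    intro i
    -- Step `i` sends its own seed, the transform of `f i`, to zero, and all later steps preserve
    -- zero.
    refine operatorProd_eq_zero _ V (Nat.succ_le_of_lt i.2) (Subtype.ext ?_)
    rw [← hV _ (Nat.succ_le_of_lt i.2)]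
    funext x t
    change dx (iter f i (f i)) x t - dx (iter f i (f i)) x t / iter f i (f i) x t
      * iter f i (f i) x t = 0
    rw [div_mul_cancel₀ _ (hne i i.2 x t), sub_self]
  have hsnoc : Fin.snoc (α := fun _ => ℝ → ℝ → 𝕜) (fun i : Fin m => f i) g
      = fun j => (Fin.snoc (α := fun _ => smoothFun 𝕜) F G j).1 := by
    funext j
    induction j using Fin.lastCases with
    | last => rw [Fin.snoc_last, Fin.snoc_last]
    | cast j => rw [Fin.snoc_castSucc, Fin.snoc_castSucc]
  rw [hsnoc, wronskian_eq_evalPt, ringWronskian_snoc _ V F hkill, map_mul, ← wronskian_eq_evalPt,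
    evalPt_apply, ← hV m le_rfl]

/-- Crum's formula with `g = f m`. Hence the Wronskian is the product of the successive seeds, which
gives both its nonvanishing and the formula for the potential. -/
theorem wronskian_succ {f : ℕ → ℝ → ℝ → 𝕜} {m : ℕ} (hf : ∀ i < m + 1, Smooth (f i))
    (hne : ∀ i < m + 1, ∀ x t, iter f i (f i) x t ≠ 0) (x t : ℝ) :
    wronskian (fun i : Fin (m + 1) => f i) x t
      = wronskian (fun i : Fin m => f i) x t * iter f m (f m) x t := by
  rw [← wronskian_snoc (fun i hi => hf i (by omega)) (fun i hi => hne i (by omega))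
    (hf m (by omega))]
  congr 2
  funext j
  induction j using Fin.lastCases with
  | last => rw [Fin.snoc_last]; rfl
  | cast j => rw [Fin.snoc_castSucc]; rfl

theorem wronskian_ne_zero {f : ℕ → ℝ → ℝ → 𝕜} {m : ℕ} (hf : ∀ i < m, Smooth (f i))
    (hne : ∀ i < m, ∀ x t, iter f i (f i) x t ≠ 0) (x t : ℝ) :
    wronskian (fun i : Fin m => f i) x t ≠ 0 := by
  induction m with
  | zero => simp [wronskian]
  | succ m ih =>
    rw [wronskian_succ hf hne]
    exact mul_ne_zero (ih (fun i hi => hf i (by omega)) (fun i hi => hne i (by omega)))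
      (hne m (by omega) x t)

theorem Smooth.wronskian {k : ℕ} {g : Fin k → ℝ → ℝ → 𝕜} (hg : ∀ i, Smooth (g i)) :
    Smooth (wronskian g) := by
  have h : KdVSource.wronskian g
      = (ringWronskian (derivX 𝕜) (fun i => (⟨g i, hg i⟩ : smoothFun 𝕜))).1 :=
    funext fun x => funext fun t => wronskian_eq_evalPt (fun i => ⟨g i, hg i⟩) x t
  rw [h]
  exact Subtype.property _

theorem d2log_mul {g h : ℝ → ℝ → 𝕜} (hg : Smooth g) (hh : Smooth h) (hg0 : ∀ x t, g x t ≠ 0)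
    (hh0 : ∀ x t, h x t ≠ 0) (x t : ℝ) :
    d2log (fun x t => g x t * h x t) x t = d2log g x t + d2log h x t := by
  have h1 : (fun x t => dx (fun x t => g x t * h x t) x t / (g x t * h x t))
      = fun x t => dx g x t / g x t + dx h x t / h x t := by
    funext x t
    have h2 : dx (fun x t => g x t * h x t) x t = dx g x t * h x t + g x t * dx h x t :=
      ((hg.hasDerivAt_dx x t).mul (hh.hasDerivAt_dx x t)).deriv
    have := hg0 x t
    have := hh0 x t
    rw [h2]
    field_simp
  have hlog : ∀ q : ℝ → ℝ → 𝕜, Smooth q → (∀ x t, q x t ≠ 0) →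
      Smooth fun x t => dx q x t / q x t := by
    intro q hq hq0
    simp only [Smooth, div_eq_mul_inv]
    exact ContDiff.mul hq.dx (hq.inv hq0)
  rw [d2log, h1]
  exact (((hlog g hg hg0).hasDerivAt_dx x t).add ((hlog h hh hh0).hasDerivAt_dx x t)).deriv

theorem iterU_eq {f : ℕ → ℝ → ℝ → 𝕜} {m : ℕ} (hf : ∀ i < m, Smooth (f i))
    (hne : ∀ i < m, ∀ x t, iter f i (f i) x t ≠ 0) (u : ℝ → ℝ → 𝕜) (x t : ℝ) :
    iterU f u m x t = u x t + 2 * d2log (wronskian (fun i : Fin m => f i)) x t := by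
  induction m with
  | zero => simp [iterU, d2log, dx, wronskian]
  | succ m ih =>
    have hf' : ∀ i < m, Smooth (f i) := fun i hi => hf i (by omega)
    have hne' : ∀ i < m, ∀ x t, iter f i (f i) x t ≠ 0 := fun i hi => hne i (by omega)
    have h1 : wronskian (fun i : Fin (m + 1) => f i)
        = fun x t => wronskian (fun i : Fin m => f i) x t * iter f m (f m) x t :=
      funext fun x => funext fun t => wronskian_succ hf hne x t
    rw [h1, d2log_mul (Smooth.wronskian fun i => hf' i i.2)
      (Smooth.iter hf' hne' le_rfl (hf m (by omega))) (wronskian_ne_zero hf' hne')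
      (hne m (by omega))]
    simp only [iterU, ih hf' hne']
    ring

/-- Each step is linear in the transformed function and its seed carries no normalization, so the
constants factor out. -/
theorem iterSource_eq (f : ℕ → ℝ → ℝ → 𝕜) (s : ℕ → 𝕜) (g : ℝ → ℝ → 𝕜) (m : ℕ) (x t : ℝ) :
    iterSource f s g m x t = (∏ i ∈ Finset.range m, 1 / s i) * iter f m g x t := by
  induction m generalizing x with
  | zero => simp [iterSource, iter]
  | succ m ih =>
    have h1 : dx (iterSource f s g m) x t
        = (∏ i ∈ Finset.range m, 1 / s i) * dx (iter f m g) x t := by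
      simp only [dx, ih, deriv_const_mul_field]
    simp only [iterSource, iter, darboux, h1, ih, Finset.prod_range_succ]
    ring

/-- Both claims are needed in one induction: the second, applied to `f m`, shows that its transform
is an admissible seed for the next step. Working with the integral-free problem avoids any decay
condition on intermediate products. -/
theorem iterate_isSourceSolution_and_isLocalLaxSolution {n N m : ℕ} {α η : 𝕜} {lam : Fin N → 𝕜}
    {u : ℝ → ℝ → 𝕜} {φ : Fin N → ℝ → ℝ → 𝕜} (hsol : IsSourceSolution n α lam u φ) {ξ : ℕ → 𝕜}
    {f : ℕ → ℝ → ℝ → 𝕜} (hf : ∀ i < m, IsLocalLaxSolution n α η lam u φ (ξ i) (f i))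
    (hξ : ∀ i < m, ∀ j, ξ i ≠ lam j) {s : Fin N → ℕ → 𝕜}
    (hs : ∀ i < m, ∀ j, s j i ^ 2 = lam j - ξ i)
    (hne : ∀ i < m, ∀ x t, iter f i (f i) x t ≠ 0) :
    IsSourceSolution n α lam (iterU f u m) (fun j => iterSource f (s j) (φ j) m) ∧
    ∀ μ ψ, (∀ j, μ ≠ lam j) → IsLocalLaxSolution n α η lam u φ μ ψ →
      IsLocalLaxSolution n α η lam (iterU f u m) (fun j => iterSource f (s j) (φ j) m) μ
        (iter f m ψ) := by
  induction m with
  | zero => exact ⟨hsol, fun μ ψ _ h => h⟩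
  | succ m ih =>
    obtain ⟨ih1, ih2⟩ := ih (fun i hi => hf i (by omega)) (fun i hi => hξ i (by omega))
      (fun i hi => hs i (by omega)) (fun i hi => hne i (by omega))
    have hm : m < m + 1 := Nat.lt_succ_self m
    obtain ⟨h1, h2⟩ := darboux_isSourceSolution_and_isLocalLaxSolution ih1
      (ih2 (ξ m) (f m) (hξ m hm) (hf m hm)) (hne m hm) (hξ m hm) (hs m hm)
    exact ⟨h1, fun μ ψ hμ hψ => h2 μ _ hμ (ih2 μ ψ hμ hψ)⟩

end Iteration

/-! ### The integral form of the linear problem -/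

section IntegralForm

variable {𝕜 : Type*} [RCLike 𝕜]

/-- Lagrange's identity: `φ ψ` is the derivative of `(φ_x ψ - φ ψ_x) / (μ - l)`, and decay removes
the boundary term at `-∞`. -/
theorem tendsto_integral_mul {u φ ψ : ℝ → ℝ → 𝕜} {l μ : 𝕜} (hφ : Smooth φ) (hψ : Smooth ψ)
    (hφu : Schrodinger u l φ) (hψu : Schrodinger u μ ψ) (hdecay : DecaysAtBot φ ψ) (hμ : μ ≠ l)
    (x t : ℝ) :
    Tendsto (fun r : ℝ => ∫ y in r..x, φ y t * ψ y t) atBot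
      (𝓝 (1 / (μ - l) * (dx φ x t * ψ x t - φ x t * dx ψ x t))) := by
  have hμl : μ - l ≠ 0 := sub_ne_zero.mpr hμ
  have hderiv : ∀ y, HasDerivAt
      (fun y => 1 / (μ - l) * (dx φ y t * ψ y t - φ y t * dx ψ y t)) (φ y t * ψ y t) y := by
    intro y
    have h := ((((hφ.dx.hasDerivAt_dx y t).mul (hψ.hasDerivAt_dx y t)).sub
      ((hφ.hasDerivAt_dx y t).mul (hψ.dx.hasDerivAt_dx y t))).const_mul (1 / (μ - l)))
    refine h.congr_deriv ?_
    field_simp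
    linear_combination ψ y t * hφu y t - φ y t * hψu y t
  have hcont : Continuous fun y => φ y t * ψ y t :=
    (continuous_iff_continuousAt.mpr fun y => (hφ.hasDerivAt_dx y t).continuousAt).mul
      (continuous_iff_continuousAt.mpr fun y => (hψ.hasDerivAt_dx y t).continuousAt)
  have hint : ∀ r : ℝ, ∫ y in r..x, φ y t * ψ y t
      = 1 / (μ - l) * (dx φ x t * ψ x t - φ x t * dx ψ x t)
        - 1 / (μ - l) * (dx φ r t * ψ r t - φ r t * dx ψ r t) := fun r =>
    intervalIntegral.integral_eq_sub_of_hasDerivAt (fun y _ => hderiv y)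
      (hcont.intervalIntegrable _ _)
  simp only [hint]
  simpa using (((hdecay t).const_mul (1 / (μ - l))).const_sub
    (1 / (μ - l) * (dx φ x t * ψ x t - φ x t * dx ψ x t)))

variable {n N : ℕ} {α η μ : 𝕜} {lam : Fin N → 𝕜} {u : ℝ → ℝ → 𝕜} {φ : Fin N → ℝ → ℝ → 𝕜}
  {ψ : ℝ → ℝ → 𝕜}

theorem sum_mul_invDx (hsol : IsSourceSolution n α lam u φ) (hψ : Smooth ψ)
    (hψu : Schrodinger u μ ψ) (hdecay : ∀ j, DecaysAtBot (φ j) ψ) (hμ : ∀ j, μ ≠ lam j)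
    (x t : ℝ) :
    ∑ j, φ j x t * invDx (fun x t => φ j x t * ψ x t) x t
      = ∑ j, 1 / (μ - lam j) * (φ j x t * (dx (φ j) x t * ψ x t - φ j x t * dx ψ x t)) := by
  refine Finset.sum_congr rfl fun j _ => ?_
  rw [invDx, (tendsto_integral_mul (hsol.smooth_φ j) hψ (hsol.spectral j) hψu (hdecay j) (hμ j)
    x t).limUnder_eq]
  ring

theorem IsLaxSolution.isLocalLaxSolution (h : IsLaxSolution n α η u φ μ ψ)
    (hsol : IsSourceSolution n α lam u φ) (hdecay : ∀ j, DecaysAtBot (φ j) ψ)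
    (hμ : ∀ j, μ ≠ lam j) : IsLocalLaxSolution n α η lam u φ μ ψ where
  smooth := h.smooth
  schrodinger := h.schrodinger
  evolution x t := by
    rw [h.evolution, sum_mul_invDx hsol h.smooth h.schrodinger hdecay hμ]

theorem IsLocalLaxSolution.isLaxSolution (h : IsLocalLaxSolution n α η lam u φ μ ψ)
    (hsol : IsSourceSolution n α lam u φ) (hdecay : ∀ j, DecaysAtBot (φ j) ψ)
    (hμ : ∀ j, μ ≠ lam j) : IsLaxSolution n α η u φ μ ψ where
  smooth := h.smooth
  schrodinger := h.schrodinger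
  converges j x t := ⟨_, tendsto_integral_mul (hsol.smooth_φ j) h.smooth (hsol.spectral j)
    h.schrodinger (hdecay j) (hμ j) x t⟩
  evolution x t := by
    rw [h.evolution, sum_mul_invDx hsol h.smooth h.schrodinger hdecay hμ]

end IntegralForm

end KdVSource

theorem theorem5p3 {𝕜 : Type*} [RCLike 𝕜] (n N m : ℕ) (α η : 𝕜)
    -- a solution of the equation with sources
    (lam : Fin N → 𝕜) (u : ℝ → ℝ → 𝕜) (φ : Fin N → ℝ → ℝ → 𝕜)
    (hsol : KdVSource.IsSourceSolution n α lam u φ)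
    -- the seeds `f 0, …, f (m - 1)`, with spectral parameters `ξ 0, …, ξ (m - 1)`
    (ξ : ℕ → 𝕜) (f : ℕ → ℝ → ℝ → 𝕜)
    (hf : ∀ i < m, KdVSource.IsLaxSolution n α η u φ (ξ i) (f i))
    (hfdecay : ∀ i < m, ∀ j, KdVSource.DecaysAtBot (φ j) (f i))
    -- square roots of the numbers `lam j - ξ i`, which are not zero
    (hξ : ∀ i < m, ∀ j, lam j ≠ ξ i)
    (s : Fin N → ℕ → 𝕜) (hs : ∀ i < m, ∀ j, s j i ^ 2 = lam j - ξ i)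
    -- every step of the repeated transformation is defined
    (hne : ∀ i < m, ∀ x t, KdVSource.iter f i (f i) x t ≠ 0) :
    (∀ x t, KdVSource.wronskian (fun i : Fin m => f i) x t ≠ 0) ∧
    (∀ x t, KdVSource.iterU f u m x t =
      u x t + 2 * KdVSource.d2log (KdVSource.wronskian (fun i : Fin m => f i)) x t) ∧
    (∀ j x t, KdVSource.iterSource f (s j) (φ j) m x t =
      (∏ i ∈ Finset.range m, 1 / s j i) *
        (KdVSource.wronskian (Fin.snoc (α := fun _ => ℝ → ℝ → 𝕜) (fun i : Fin m => f i) (φ j)) x t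
          / KdVSource.wronskian (fun i : Fin m => f i) x t)) ∧
    KdVSource.IsSourceSolution n α lam (KdVSource.iterU f u m)
      (fun j => KdVSource.iterSource f (s j) (φ j) m) ∧
    (∀ (μ : 𝕜) (ψ : ℝ → ℝ → 𝕜), (∀ j, μ ≠ lam j) →
      KdVSource.IsLaxSolution n α η u φ μ ψ →
      (∀ j, KdVSource.DecaysAtBot (φ j) ψ) →
      (∀ x t, KdVSource.iter f m ψ x t =
        KdVSource.wronskian (Fin.snoc (α := fun _ => ℝ → ℝ → 𝕜) (fun i : Fin m => f i) ψ) x t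
          / KdVSource.wronskian (fun i : Fin m => f i) x t) ∧
      KdVSource.IsLocalLaxSolution n α η lam (KdVSource.iterU f u m)
        (fun j => KdVSource.iterSource f (s j) (φ j) m) μ (KdVSource.iter f m ψ) ∧
      ((∀ j, KdVSource.DecaysAtBot (KdVSource.iterSource f (s j) (φ j) m)
          (KdVSource.iter f m ψ)) →
        KdVSource.IsLaxSolution n α η (KdVSource.iterU f u m)
          (fun j => KdVSource.iterSource f (s j) (φ j) m) μ (KdVSource.iter f m ψ))) := by
  have hf' : ∀ i < m, KdVSource.Smooth (f i) := fun i hi => (hf i hi).smooth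
  have hξ' : ∀ i < m, ∀ j, ξ i ≠ lam j := fun i hi j => (hξ i hi j).symm
  have hquot : ∀ g, KdVSource.Smooth g → ∀ x t, KdVSource.iter f m g x t =
      KdVSource.wronskian (Fin.snoc (α := fun _ => ℝ → ℝ → 𝕜) (fun i : Fin m => f i) g) x t
        / KdVSource.wronskian (fun i : Fin m => f i) x t := fun g hg x t => by
    rw [KdVSource.wronskian_snoc hf' hne hg,
      mul_div_cancel_left₀ _ (KdVSource.wronskian_ne_zero hf' hne x t)]
  -- Decay of the products with the seeds serves only to put the original seeds into integral-free
  -- form.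
  obtain ⟨h1, h2⟩ := KdVSource.iterate_isSourceSolution_and_isLocalLaxSolution hsol
    (fun i hi => (hf i hi).isLocalLaxSolution hsol (hfdecay i hi) (hξ' i hi)) hξ' hs hne
  refine ⟨KdVSource.wronskian_ne_zero hf' hne, KdVSource.iterU_eq hf' hne u, fun j x t => ?_, h1,
    fun μ ψ hμ hψ hψdecay => ?_⟩
  · rw [KdVSource.iterSource_eq, hquot _ (hsol.smooth_φ j)]
  · have h3 := h2 μ ψ hμ (hψ.isLocalLaxSolution hsol hψdecay hμ)
    exact ⟨hquot ψ hψ.smooth, h3, fun hdecay => h3.isLaxSolution h1 hdecay hμ⟩
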